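/- Let $p=(p_k)_{k\ge 0}$ be a probability distribution on $\{0,1,2,\dots\}$ and let $\{X_n\}_{n\ge0}$ be the stationary classical binary renewal process with run-length distribution $p$: $X_n=0$ if $M_n=0$ and $X_n=1$ if $M_n\ge1$, where $\{M_n\}$ is a stationary Markov chain on $\{0,1,2,\dots\}$ with transition probabilities $p_{0,i}=p_i$ and $p_{i,i-1}=1$ for $i\ge1$. Write $X_0^n=(X_0,\dots,X_n)$. Let $\psi=\min\{t\ge0: X_t=0\}$. For $n\ge\psi$ let $\tau(X_0^n)$ be the $t\in\{0,\dots,n\}$ such that $X_{n-t}=0$ and $X_i=1$ for $n-t<i\le n$. Let $\sigma_i=\max\{l\ge0: X_j=1\text{ for } i<j\le i+l\}$ and $\theta_n=E(\sigma_n\mid X_0^n)$. For $0<\gamma<1$ let $\lambda_0=\psi$ and, for $n\ge1$, $$\lambda_n=\min\{k>\lambda_{n-1}: |\{\psi\le i<k:\tau(X_0^i)=\tau(X_0^k)\}|\ge k^{1-\gamma}\},$$ $$\kappa_n=\max\{K: |\{k:\ K\le k<\lambda_n,\ k\ge\psi,\ \tau(X_0^k)=\tau(X_0^{\lambda_n})\}|=\lceil\lambda_n^{1-\gamma}\rceil\},$$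 $$h_n=\frac1{\lceil\lambda_n^{1-\gamma}\rceil}\sum_{i=\kappa_n}^{\lambda_n-1} I_{\{\tau(X_0^i)=\tau(X_0^{\lambda_n})\}}\,\sigma_i,\qquad \hat p_l=\frac1{\lceil\lambda_n^{1-\gamma}\rceil}\sum_{i=\kappa_n}^{\lambda_n-1} I_{\{\tau(X_0^i)=\tau(X_0^{\lambda_n}),\ \sigma_i=l\}}\quad(l\ge0)$$ (the $\hat p_l$ depend on $n$). **Theorem.** Assume $\sum_{k=0}^\infty k^{\alpha+1}p_k<\infty$ for some $\alpha>2$, and let $0<\gamma<\min(1-2/\alpha,\,1/3)$. Then, almost surely, $$\lim_{n\to\infty}\frac{\lambda_n}{n}=1,\qquad \lim_{n\to\infty}|h_n-\theta_{\lambda_n}|=0,\qquad \lim_{n\to\infty}\sum_{l=0}^\infty\left|\hat p_l-\frac{p_{l+\tau(X_0^{\lambda_n})}}{\sum_{i=\tau(X_0^{\lambda_n})}^\infty p_i}\right|=0 .$$ -/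

import Mathlib

open MeasureTheory Filter Topology

noncomputable section

namespace BinaryRenewal

/-- Transition probabilities of the underlying Markov chain on `{0, 1, 2, …}`:
from `0` one jumps to `j` with probability `p j`, from `i + 1` one moves to `i`. -/
def transProb (p : ℕ → ℝ) : ℕ → ℕ → ℝ
  | 0, j => p j
  | i + 1, j => if j = i then 1 else 0

/-- `M` is a stationary Markov chain with transition probabilities `transProb p`. -/
structure IsStationaryChain {Ω : Type*} [MeasurableSpace Ω] (P : Measure Ω)
    (p : ℕ → ℝ) (M : ℕ → Ω → ℕ) : Prop where
  measurable : ∀ n, Measurable (M n)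
  /-- Finite dimensional distributions of a Markov chain. -/
  markov : ∀ (n : ℕ) (s : ℕ → ℕ),
    P.real {ω | ∀ i ≤ n, M i ω = s i} =
      P.real {ω | M 0 ω = s 0} * ∏ i ∈ Finset.range n, transProb p (s i) (s (i + 1))
  /-- The initial law is invariant. -/
  stationary : ∀ n j : ℕ, P.real {ω | M n ω = j} = P.real {ω | M 0 ω = j}

/-- Collapsing all states `i ≥ 1` to `1`. -/
def collapse (m : ℕ) : Fin 2 := if m = 0 then 0 else 1

/-- `X` is the stationary classical binary renewal process with run length distribution `p`:
almost surely it is obtained from the stationary chain by collapsing the states `i ≥ 1`. -/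
structure IsBinaryRenewal {Ω : Type*} [MeasurableSpace Ω] (P : Measure Ω)
    (p : ℕ → ℝ) (X : ℕ → Ω → Fin 2) : Prop where
  measurable : ∀ n, Measurable (X n)
  exists_chain : ∃ M : ℕ → Ω → ℕ, IsStationaryChain P p M ∧
    ∀ᵐ ω ∂P, ∀ n, X n ω = collapse (M n ω)

/-- The sample path of `X` at `ω`. -/
def path {Ω : Type*} (X : ℕ → Ω → Fin 2) (ω : Ω) : ℕ → Fin 2 := fun n => X n ω

/-- Position `ψ` of the first zero. -/
def psi (x : ℕ → Fin 2) : ℕ := sInf {t | x t = 0}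

/-- `τ(x_0, …, x_n)`: the `t` such that `x_{n-t} = 0` and `x_i = 1` for `n - t < i ≤ n`.
Meaningful only if a zero occurs among `x_0, …, x_n`, that is, for `n ≥ ψ`. -/
def tau (x : ℕ → Fin 2) (n : ℕ) : ℕ :=
  sInf {t | t ≤ n ∧ x (n - t) = 0 ∧ ∀ i, n - t < i → i ≤ n → x i = 1}

/-- `σ_i`: the length of the run of `1`s following position `i`
(the value is irrelevant if the run is infinite, an event of probability zero). -/
def sigma (x : ℕ → Fin 2) (i : ℕ) : ℕ :=
  sSup {l | ∀ j, i < j → j ≤ i + l → x j = 1}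

/-- The number of `i` with `ψ ≤ i`, `K ≤ i < k` and `τ(x_0^i) = τ(x_0^k)`. -/
def count (x : ℕ → Fin 2) (K k : ℕ) : ℕ :=
  ((Finset.Ico K k).filter (fun i => psi x ≤ i ∧ tau x i = tau x k)).card

/-- The stopping times `λ_n`. (If some minimum is over the empty set, the sequence obtained
here is bounded, so that `λ_n / n → 0`.) -/
def lam (γ : ℝ) (x : ℕ → Fin 2) : ℕ → ℕ
  | 0 => psi x
  | n + 1 => sInf {k | lam γ x n < k ∧ (k : ℝ) ^ (1 - γ) ≤ (count x (psi x) k : ℝ)}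

/-- The number `⌈λ_n ^ (1 - γ)⌉` of occurrences that are used at time `λ_n`. -/
def sampleSize (γ : ℝ) (x : ℕ → Fin 2) (n : ℕ) : ℕ :=
  ⌈(lam γ x n : ℝ) ^ (1 - γ)⌉₊

/-- The index `κ_n`. -/
def kappa (γ : ℝ) (x : ℕ → Fin 2) (n : ℕ) : ℕ :=
  sSup {K | count x K (lam γ x n) = sampleSize γ x n}

/-- The estimator `h_n` of the expected residual waiting time. -/
def hEst (γ : ℝ) (x : ℕ → Fin 2) (n : ℕ) : ℝ :=
  1 / (sampleSize γ x n : ℝ) *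
    ∑ i ∈ Finset.Ico (kappa γ x n) (lam γ x n),
      if tau x i = tau x (lam γ x n) then (sigma x i : ℝ) else 0

/-- The estimator `p̂_l` of the distribution of the residual waiting time. -/
def pEst (γ : ℝ) (x : ℕ → Fin 2) (n l : ℕ) : ℝ :=
  1 / (sampleSize γ x n : ℝ) *
    ∑ i ∈ Finset.Ico (kappa γ x n) (lam γ x n),
      if tau x i = tau x (lam γ x n) ∧ sigma x i = l then (1 : ℝ) else 0

/-- The σ-algebra generated by `X_0, …, X_n`. -/
abbrev sigmaAlg {Ω : Type*} (X : ℕ → Ω → Fin 2) (n : ℕ) : MeasurableSpace Ω :=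
  MeasurableSpace.comap (fun ω (i : Fin (n + 1)) => X i ω) inferInstance

/-- `θ_n = E(σ_n | X_0, …, X_n)`, the conditional expectation of the residual waiting time. -/
def theta {Ω : Type*} [MeasurableSpace Ω] (P : Measure Ω) (X : ℕ → Ω → Fin 2) (n : ℕ) :
    Ω → ℝ :=
  P[fun ω => (sigma (path X ω) n : ℝ) | sigmaAlg X n]

/-- The conditional probability `p_{l+L} / ∑_{i ≥ L} p_i` that the residual waiting time is `l`
when the last zero was seen `L` steps ago. -/
def residual (p : ℕ → ℝ) (L l : ℕ) : ℝ := p (l + L) / ∑' i, p (i + L)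

end BinaryRenewal

end

/-!
The whole argument runs in real time along the underlying chain `M`, without passing to the
sequence of runs.

Almost surely `M` decreases by one step at a time away from `0`. Along such a trajectory
`σ_i = M_{i+1}`, and the times `i` with `τ = L` are exactly the times `i = z + L` where `z` is a zero
followed by a run of length `R = M_{z+1} ≥ L`; then `σ_i = R - L`. Hence the deviation of an
empirical average over the window `[κ_n, λ_n)` from the corresponding conditional mean `c` of
`F (R - L)` given `R ≥ L` is a difference of two partial sums
`∑_{z < t, M_z = 0} f (M_{z+1})`, divided by the sample size, with `f r = F (r - L) - c` for `r ≥ L`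
and `f r = 0` otherwise (`IsTrajectory.abs_average_sub_le`). Since the sample size is at least
`λ_n ^ (1 - γ)`, it suffices that these partial sums are `o(k ^ (1 - γ))` up to time `k`, uniformly
in the level `L`.

Such an `f` is centered under `p`, and given `M_z = 0` the value `M_{z+1}` is independent of the past
with law `p` (`map_history_next`). The partial sums therefore form a square integrable martingale,
and Doob's maximal inequality along dyadic times with Borel–Cantelli gives the uniform bound for any
countable family of functions with summable second moments, as soon as `γ < 1 / 2`
(`ae_eventually_abs_runSum_le`). The theorem needs three families:

* `F l = l` at all levels `L`, for the estimator `h_n`;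
* the point masses at `l` with weight `(l + 1) ^ (α / 2)`, at all levels `L`, for `p̂`: the weights
  have summable inverses because `α > 2`, so uniform control of them is control in `ℓ¹`, and the sum
  of the second moments over `l` and `L` is bounded by a moment of order `α + 1`;
* `F r = r + 1` for `r ≥ B`, at level `0`: these bound the proportion of time with `τ ≥ B`, which is
  small for large `B`. As a value `τ = L` is rare at no more than `k ^ (1 - γ) + 1` times up to `k`,
  the rare times have density zero and `λ_n / n → 1` (`tendsto_lam_div`).

Finally `θ_n` is constant on the atoms of `σ(X_0, …, X_n)`, and integrating over an atom that
contains a zero identifies it with the conditional mean of `R - L` given `R ≥ L`, `L = τ(X_0^n)`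
(`ae_theta_eq`). Stationarity enters only here, to make `σ_n` integrable.
-/

noncomputable section

namespace BinaryRenewal

/-! ### Trajectories -/

/-- `m` is a trajectory of the underlying chain that decreases by one step at a time away from `0`,
and `x` is obtained from it by collapsing the positive states. -/
structure IsTrajectory (x : ℕ → Fin 2) (m : ℕ → ℕ) : Prop where
  dec : ∀ n k, m n = k + 1 → m (n + 1) = k
  collapse_eq : ∀ n, x n = collapse (m n)

/-- The sum of `f` over the lengths of the runs of `1`s that start right after a zero of `m`
located before time `t`. -/
def runSum (f : ℕ → ℝ) (m : ℕ → ℕ) (t : ℕ) : ℝ :=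
  ∑ z ∈ Finset.range t, if m z = 0 then f (m (z + 1)) else 0

namespace IsTrajectory

variable {x : ℕ → Fin 2} {m : ℕ → ℕ}

lemma eq_zero_iff (h : IsTrajectory x m) (n : ℕ) : x n = 0 ↔ m n = 0 := by
  rw [h.collapse_eq, collapse]; split_ifs with h0 <;> simp [h0]

lemma eq_one_iff (h : IsTrajectory x m) (n : ℕ) : x n = 1 ↔ m n ≠ 0 := by
  rw [h.collapse_eq, collapse]; split_ifs with h0 <;> simp [h0]

lemma apply_add (h : IsTrajectory x m) (n j : ℕ) (hj : j ≤ m n) : m (n + j) = m n - j := by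
  induction j with
  | zero => simp
  | succ j ih =>
    have h1 := ih (by omega)
    have h2 := h.dec (n + j) (m n - (j + 1)) (by omega)
    rw [← h2]; rfl

lemma psi_eq (h : IsTrajectory x m) : psi x = m 0 := by
  have h0 := h.apply_add 0 (m 0) le_rfl
  apply le_antisymm
  · apply Nat.sInf_le
    simp only [Set.mem_ofPred_eq, h.eq_zero_iff]
    simpa using h0
  · apply le_csInf
    · refine ⟨m 0, ?_⟩
      simp only [Set.mem_ofPred_eq, h.eq_zero_iff]
      simpa using h0
    · intro t ht
      simp only [Set.mem_ofPred_eq, h.eq_zero_iff] at ht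
      by_contra! hlt
      have := h.apply_add 0 t hlt.le
      rw [zero_add] at this
      omega

lemma apply_psi (h : IsTrajectory x m) : m (psi x) = 0 := by
  have h0 := h.apply_add 0 (m 0) le_rfl
  rw [h.psi_eq]; simpa using h0

lemma tau_eq_iff (h : IsTrajectory x m) {i : ℕ} (hi : psi x ≤ i) (L : ℕ) :
    tau x i = L ↔ L ≤ i ∧ m (i - L) = 0 ∧ ∀ j, i - L < j → j ≤ i → m j ≠ 0 := by
  have hset : ∀ t, t ∈ {t | t ≤ i ∧ x (i - t) = 0 ∧ ∀ j, i - t < j → j ≤ i → x j = 1} ↔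
      (t ≤ i ∧ m (i - t) = 0 ∧ ∀ j, i - t < j → j ≤ i → m j ≠ 0) := by
    intro t
    simp only [Set.mem_ofPred_eq, h.eq_zero_iff, h.eq_one_iff]
  have hne : {t | t ≤ i ∧ x (i - t) = 0 ∧ ∀ j, i - t < j → j ≤ i → x j = 1}.Nonempty := by
    set z := Nat.findGreatest (fun z => m z = 0) i with hz
    have hzi : z ≤ i := Nat.findGreatest_le i
    have hz0 : m z = 0 := Nat.findGreatest_spec (P := fun z => m z = 0) hi h.apply_psi
    refine ⟨i - z, (hset _).2 ⟨Nat.sub_le _ _, ?_, ?_⟩⟩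
    · rwa [Nat.sub_sub_self hzi]
    · rw [Nat.sub_sub_self hzi]
      intro j hj hji
      exact Nat.findGreatest_is_greatest (P := fun z => m z = 0) hj hji
  have hmem := (hset _).1 (Nat.sInf_mem hne)
  change tau x i ≤ i ∧ m (i - tau x i) = 0 ∧ ∀ j, i - tau x i < j → j ≤ i → m j ≠ 0 at hmem
  constructor
  · rintro rfl; exact hmem
  · rintro ⟨h1, h2, h3⟩
    obtain ⟨g1, g2, g3⟩ := hmem
    rcases lt_trichotomy (tau x i) L with hlt | heq | hgt
    · exact absurd g2 (h3 _ (by omega) (by omega))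
    · exact heq
    · exact absurd h2 (g3 _ (by omega) (by omega))

lemma tau_le (h : IsTrajectory x m) {i : ℕ} (hi : psi x ≤ i) : tau x i ≤ i :=
  ((h.tau_eq_iff hi _).1 rfl).1

/-- Times with last zero `L` steps ago are the times `z + L` with `z` the beginning of a run of
length at least `L`. -/
lemma tau_add_iff (h : IsTrajectory x m) {z L : ℕ} (hz : psi x ≤ z + L) :
    tau x (z + L) = L ↔ m z = 0 ∧ L ≤ m (z + 1) := by
  rw [h.tau_eq_iff hz, Nat.add_sub_cancel]
  constructor
  · rintro ⟨-, h2, h3⟩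
    refine ⟨h2, ?_⟩
    by_contra! hlt
    have := h.apply_add (z + 1) (m (z + 1)) le_rfl
    exact h3 _ (by omega) (by omega) (this.trans (Nat.sub_self _))
  · rintro ⟨h2, h3⟩
    refine ⟨by omega, h2, fun j hj hjL => ?_⟩
    have := h.apply_add (z + 1) (j - (z + 1)) (by omega)
    rw [show z + 1 + (j - (z + 1)) = j by omega] at this
    omega

lemma sigma_eq (h : IsTrajectory x m) (i : ℕ) : sigma x i = m (i + 1) := by
  have : {l | ∀ j, i < j → j ≤ i + l → x j = 1} = Set.Iic (m (i + 1)) := by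
    ext l
    simp only [Set.mem_ofPred_eq, h.eq_one_iff, Set.mem_Iic]
    constructor
    · intro hl
      by_contra! hlt
      have := h.apply_add (i + 1) (m (i + 1)) le_rfl
      exact hl _ (by omega) (by omega) (this.trans (Nat.sub_self _))
    · intro hl j hj hjl
      have := h.apply_add (i + 1) (j - (i + 1)) (by omega)
      rw [show i + 1 + (j - (i + 1)) = j by omega] at this
      omega
  rw [sigma, this, csSup_Iic]

/-- A sum over the times in a window with last zero `L` steps ago is a difference of two
`runSum`s. -/
lemma sum_window (h : IsTrajectory x m) (F : ℕ → ℝ) {K k L : ℕ} (hK : psi x ≤ K) (hLK : L ≤ K)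
    (hKk : K ≤ k) :
    ∑ i ∈ Finset.Ico K k, (if tau x i = L then F (sigma x i) else 0) =
      runSum (fun r => if L ≤ r then F (r - L) else 0) m (k - L) -
        runSum (fun r => if L ≤ r then F (r - L) else 0) m (K - L) := by
  rw [runSum, runSum, ← Finset.sum_Ico_eq_sub _ (Nat.sub_le_sub_right hKk L)]
  have h1 : Finset.Ico K k = Finset.Ico (K - L + L) (k - L + L) := by
    rw [Nat.sub_add_cancel hLK, Nat.sub_add_cancel (hLK.trans hKk)]
  rw [h1, ← Finset.sum_Ico_add' (fun i => if tau x i = L then F (sigma x i) else 0)]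
  refine Finset.sum_congr rfl fun z hz => ?_
  have hz' := (Finset.mem_Ico.1 hz).1
  simp only [h.tau_add_iff (show psi x ≤ z + L by omega), h.sigma_eq]
  by_cases h0 : m z = 0
  · by_cases hL : L ≤ m (z + 1)
    · have := h.apply_add (z + 1) L hL
      rw [show z + L + 1 = z + 1 + L by ring, this]
      simp [h0, hL]
    · simp [h0, hL]
  · simp [h0]

end IsTrajectory

/-! ### The stopping times -/

/-- The times in `(ψ, k]` at which the current value of `τ` has not yet been seen often enough. -/
def rareTimes (γ : ℝ) (x : ℕ → Fin 2) (k : ℕ) : Finset ℕ :=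
  (Finset.Ioc (psi x) k).filter fun i => ¬ ((i : ℝ) ^ (1 - γ) ≤ (count x (psi x) i : ℝ))

lemma count_lt_count {x : ℕ → Fin 2} {i j : ℕ} (hi : psi x ≤ i) (hij : i < j)
    (ht : tau x i = tau x j) : count x (psi x) i < count x (psi x) j := by
  apply Finset.card_lt_card
  rw [Finset.ssubset_iff_of_subset]
  · refine ⟨i, ?_, ?_⟩
    · simp [hi, hij, ht]
    · simp
  · intro a
    simp only [Finset.mem_filter, Finset.mem_Ico, ht]
    rintro ⟨⟨h1, h2⟩, h3⟩
    exact ⟨⟨h1, h2.trans hij⟩, h3⟩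

/-- Each value `L` of `τ` is rare at few times only, since the count of its earlier occurrences
increases strictly from one occurrence to the next. -/
lemma card_rareTimes_tau_le {γ : ℝ} (hγ : γ ≤ 1) (x : ℕ → Fin 2) (k L : ℕ) :
    (((rareTimes γ x k).filter fun i => tau x i = L).card : ℝ) ≤ (k : ℝ) ^ (1 - γ) + 1 := by
  have h1 : ((rareTimes γ x k).filter fun i => tau x i = L).card ≤
      (Finset.range ⌈(k : ℝ) ^ (1 - γ)⌉₊).card := by
    apply Finset.card_le_card_of_injOn (fun i => count x (psi x) i)
    · intro i hi
      simp only [rareTimes, Finset.coe_filter, Finset.mem_filter, Finset.mem_Ioc,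
        Set.mem_ofPred_eq, not_le] at hi
      simp only [Finset.coe_range, Set.mem_Iio]
      rw [Nat.lt_ceil]
      refine hi.1.2.trans_le ?_
      exact Real.rpow_le_rpow (Nat.cast_nonneg _) (Nat.cast_le.2 hi.1.1.2) (by linarith)
    · intro i hi j hj hij
      simp only [rareTimes, Finset.coe_filter, Finset.mem_filter, Finset.mem_Ioc,
        Set.mem_ofPred_eq, not_le] at hi hj
      simp only at hij
      rcases lt_trichotomy i j with h | h | h
      · exact absurd hij (count_lt_count hi.1.1.1.le h (hi.2.trans hj.2.symm)).ne
      · exact h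
      · exact absurd hij (count_lt_count hj.1.1.1.le h (hj.2.trans hi.2.symm)).ne'
  rw [Finset.card_range] at h1
  have h2 : (0 : ℝ) ≤ (k : ℝ) ^ (1 - γ) := by positivity
  exact (Nat.cast_le.2 h1).trans (Nat.ceil_lt_add_one h2).le

/-- Only runs of length `r ≥ B` contribute times with `τ ≥ B`, at most `r + 1` each. -/
lemma IsTrajectory.card_tau_ge_le {x : ℕ → Fin 2} {m : ℕ → ℕ} (h : IsTrajectory x m) (k B : ℕ) :
    (((Finset.Ioc (psi x) k).filter fun i => B ≤ tau x i).card : ℝ) ≤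
      runSum (fun r => if B ≤ r then (r : ℝ) + 1 else 0) m (k + 1) := by
  have hsub : ((Finset.Ioc (psi x) k).filter fun i => B ≤ tau x i) ⊆
      (Finset.range (k + 1)).biUnion fun z => if m z = 0 then
        (if B ≤ m (z + 1) then (Finset.range (m (z + 1) + 1)).image (z + ·) else ∅) else ∅ := by
    intro i hi
    simp only [Finset.mem_filter, Finset.mem_Ioc] at hi
    have hle := h.tau_le hi.1.1.le
    have hz : psi x ≤ i - tau x i + tau x i := by omega
    have hiff := (h.tau_add_iff hz).1 (by rw [Nat.sub_add_cancel hle])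
    simp only [Finset.mem_biUnion, Finset.mem_range]
    refine ⟨i - tau x i, by omega, ?_⟩
    rw [if_pos hiff.1, if_pos (hi.2.trans hiff.2)]
    simp only [Finset.mem_image, Finset.mem_range]
    exact ⟨tau x i, by omega, by omega⟩
  have h1 := (Finset.card_le_card hsub).trans Finset.card_biUnion_le
  refine (Nat.cast_le.2 h1).trans ?_
  rw [runSum]
  push_cast
  refine Finset.sum_le_sum fun z _ => ?_
  split_ifs
  · refine (Nat.cast_le.2 Finset.card_image_le).trans ?_
    simp
  · simp
  · simp

lemma IsTrajectory.card_rareTimes_le {γ : ℝ} (hγ : γ ≤ 1) {x : ℕ → Fin 2} {m : ℕ → ℕ}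
    (h : IsTrajectory x m) (k B : ℕ) :
    ((rareTimes γ x k).card : ℝ) ≤ B * ((k : ℝ) ^ (1 - γ) + 1) +
      runSum (fun r => if B ≤ r then (r : ℝ) + 1 else 0) m (k + 1) := by
  have hsub : rareTimes γ x k ⊆
      ((Finset.range B).biUnion fun L => (rareTimes γ x k).filter fun i => tau x i = L) ∪
        ((Finset.Ioc (psi x) k).filter fun i => B ≤ tau x i) := by
    intro i hi
    rw [Finset.mem_union]
    by_cases hB : B ≤ tau x i
    · right
      exact Finset.mem_filter.2 ⟨(Finset.mem_filter.1 hi).1, hB⟩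
    · left
      simp only [Finset.mem_biUnion, Finset.mem_range, Finset.mem_filter]
      exact ⟨tau x i, by omega, hi, rfl⟩
  have h1 := (Finset.card_le_card hsub).trans (Finset.card_union_le _ _)
  have h2 : (((Finset.range B).biUnion fun L =>
      (rareTimes γ x k).filter fun i => tau x i = L).card : ℝ) ≤ B * ((k : ℝ) ^ (1 - γ) + 1) := by
    refine (Nat.cast_le.2 Finset.card_biUnion_le).trans ?_
    push_cast
    refine (Finset.sum_le_sum fun L _ => card_rareTimes_tau_le hγ x k L).trans ?_
    simp [mul_add]
  have h3 := h.card_tau_ge_le k B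
  have h4 : ((rareTimes γ x k).card : ℝ) ≤ _ := Nat.cast_le.2 h1
  push_cast at h4
  linarith

section Lam

variable {γ : ℝ} {x : ℕ → Fin 2}

lemma lam_succ_mem (hA : ∀ a : ℕ, ∃ k, a < k ∧ (k : ℝ) ^ (1 - γ) ≤ (count x (psi x) k : ℝ))
    (n : ℕ) : lam γ x n < lam γ x (n + 1) ∧
      (lam γ x (n + 1) : ℝ) ^ (1 - γ) ≤ (count x (psi x) (lam γ x (n + 1)) : ℝ) :=
  Nat.sInf_mem (s := {k | lam γ x n < k ∧ (k : ℝ) ^ (1 - γ) ≤ (count x (psi x) k : ℝ)})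
    (hA (lam γ x n))

/-- `λ_n` is the `n`-th non-rare time after `ψ`. -/
lemma lam_eq (hA : ∀ a : ℕ, ∃ k, a < k ∧ (k : ℝ) ^ (1 - γ) ≤ (count x (psi x) k : ℝ)) (n : ℕ) :
    lam γ x n = psi x + n + (rareTimes γ x (lam γ x n)).card ∧ psi x ≤ lam γ x n := by
  induction n with
  | zero => simp [lam, rareTimes]
  | succ n ih =>
    obtain ⟨h1, h2⟩ := lam_succ_mem hA n
    have hle : psi x ≤ lam γ x (n + 1) := ih.2.trans h1.le
    refine ⟨?_, hle⟩
    have hunion : rareTimes γ x (lam γ x (n + 1)) =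
        rareTimes γ x (lam γ x n) ∪ Finset.Ioo (lam γ x n) (lam γ x (n + 1)) := by
      ext i
      simp only [rareTimes, Finset.mem_filter, Finset.mem_Ioc, Finset.mem_union, Finset.mem_Ioo]
      constructor
      · rintro ⟨⟨a1, a2⟩, a3⟩
        by_cases hi : i ≤ lam γ x n
        · exact Or.inl ⟨⟨a1, hi⟩, a3⟩
        · refine Or.inr ⟨not_le.1 hi, lt_of_le_of_ne a2 ?_⟩
          rintro rfl
          exact a3 h2
      · rintro (⟨⟨a1, a2⟩, a3⟩ | ⟨a1, a2⟩)
        · exact ⟨⟨a1, a2.trans h1.le⟩, a3⟩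
        · refine ⟨⟨ih.2.trans_lt a1, a2.le⟩, fun a3 => ?_⟩
          exact Nat.notMem_of_lt_sInf a2 ⟨a1, a3⟩
    rw [hunion, Finset.card_union_of_disjoint, Nat.card_Ioo]
    · omega
    · rw [Finset.disjoint_left]
      intro i hi hi'
      simp only [rareTimes, Finset.mem_filter, Finset.mem_Ioc, Finset.mem_Ioo] at hi hi'
      omega

lemma exists_gt_of_rareTimes
    (hD : Tendsto (fun k : ℕ => ((rareTimes γ x k).card : ℝ) / k) atTop (𝓝 0)) (a : ℕ) :
    ∃ k, a < k ∧ (k : ℝ) ^ (1 - γ) ≤ (count x (psi x) k : ℝ) := by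
  by_contra! hcon
  have h1 : ∀ᶠ k : ℕ in atTop, ((rareTimes γ x k).card : ℝ) / k < 1 / 2 :=
    hD.eventually (gt_mem_nhds (by norm_num))
  obtain ⟨k, hk1, hk2⟩ := (h1.and (eventually_ge_atTop (2 * (a + psi x) + 1))).exists
  have hsub : Finset.Ioc (a + psi x) k ⊆ rareTimes γ x k := by
    intro i hi
    simp only [rareTimes, Finset.mem_filter, Finset.mem_Ioc, not_le] at hi ⊢
    exact ⟨⟨by omega, hi.2⟩, hcon i (by omega)⟩
  have h2 := Finset.card_le_card hsub
  rw [Nat.card_Ioc] at h2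
  have hk0 : (0 : ℝ) < k := by exact_mod_cast (show 0 < k by omega)
  rw [div_lt_iff₀ hk0] at hk1
  have h3 : (k : ℝ) ≤ 2 * ((rareTimes γ x k).card : ℝ) := by
    exact_mod_cast (show k ≤ 2 * (rareTimes γ x k).card by omega)
  linarith

lemma tendsto_lam_atTop
    (hD : Tendsto (fun k : ℕ => ((rareTimes γ x k).card : ℝ) / k) atTop (𝓝 0)) :
    Tendsto (fun n => lam γ x n) atTop atTop :=
  tendsto_atTop_mono (f := fun n => n)
    (fun n => by have := (lam_eq (exists_gt_of_rareTimes hD) n).1; omega) tendsto_id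

lemma tendsto_lam_div
    (hD : Tendsto (fun k : ℕ => ((rareTimes γ x k).card : ℝ) / k) atTop (𝓝 0)) :
    Tendsto (fun n : ℕ => (lam γ x n : ℝ) / n) atTop (𝓝 1) := by
  have hl := tendsto_lam_atTop hD
  have h1 : Tendsto (fun n => 1 - (psi x : ℝ) / (lam γ x n : ℝ) -
      ((rareTimes γ x (lam γ x n)).card : ℝ) / (lam γ x n : ℝ)) atTop (𝓝 (1 - 0 - 0)) :=
    (tendsto_const_nhds.sub
      (tendsto_const_nhds.div_atTop (tendsto_natCast_atTop_atTop.comp hl))).sub (hD.comp hl)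
  have h2 := h1.inv₀ (by norm_num)
  simp only [sub_zero, inv_one] at h2
  refine h2.congr' ?_
  filter_upwards [eventually_gt_atTop 0] with n hn
  have h3 := (lam_eq (exists_gt_of_rareTimes hD) n).1
  have h4 : (lam γ x n : ℝ) = psi x + n + ((rareTimes γ x (lam γ x n)).card : ℝ) := by
    exact_mod_cast h3
  have h5 : (0 : ℝ) < lam γ x n := by exact_mod_cast (show 0 < lam γ x n by omega)
  rw [show 1 - (psi x : ℝ) / (lam γ x n : ℝ) -
      ((rareTimes γ x (lam γ x n)).card : ℝ) / (lam γ x n : ℝ) = n / lam γ x n by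
    field_simp; linarith, inv_div]

end Lam

/-! ### The windows used by the estimators -/

lemma count_eq_add (x : ℕ → Fin 2) {K k : ℕ} (h : K < k) :
    count x K k = (if psi x ≤ K ∧ tau x K = tau x k then 1 else 0) + count x (K + 1) k := by
  rw [count, count, ← Finset.insert_Ico_add_one_left_eq_Ico h, Finset.filter_insert]
  split_ifs with hc
  · rw [Finset.card_insert_of_notMem (by simp)]
    ring
  · simp

/-- The window `[κ, k)` contains the prescribed number `s` of occurrences, and starts with one of
them. -/
lemma isGreatest_window {x : ℕ → Fin 2} {k s : ℕ} (hs : 1 ≤ s) (hk : s ≤ count x (psi x) k)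
    (hpk : psi x ≤ k) :
    ∃ K, IsGreatest {K | count x K k = s} K ∧ K < k ∧ psi x ≤ K ∧ tau x K = tau x k := by
  -- `count x K k` decreases in `K` by steps of at most one, from at least `s` to `0`.
  set K := Nat.findGreatest (fun K => s ≤ count x K k) k with hK
  have h0 : ∀ K, k ≤ K → count x K k = 0 := fun K h => by
    rw [count, Finset.Ico_eq_empty (by omega)]; simp
  have hPK : s ≤ count x K k :=
    Nat.findGreatest_spec (P := fun K => s ≤ count x K k) hpk hk
  have hlt : K < k := by
    by_contra! h
    have := h0 K h
    omega
  have hnot : ¬ s ≤ count x (K + 1) k :=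
    Nat.findGreatest_is_greatest (P := fun K => s ≤ count x K k) (Nat.lt_succ_self K) hlt
  have hstep := count_eq_add x hlt
  split_ifs at hstep with hc
  · refine ⟨K, ⟨by simp only [Set.mem_ofPred_eq]; omega, ?_⟩, hlt, hc⟩
    intro K' hK'
    simp only [Set.mem_ofPred_eq] at hK'
    apply Nat.le_findGreatest
    · by_contra! h
      have := h0 K' h.le
      omega
    · exact hK'.ge
  · omega

/-- The part `f r = F (r - L) - c`, `r ≥ L`, of the fluctuation of an estimator that is
contributed by a run of length `r`. -/
def shifted (F : ℕ → ℝ) (c : ℝ) (L r : ℕ) : ℝ := if L ≤ r then F (r - L) - c else 0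

/-- The deviation of the empirical average of `F (σ_i)` over the window `[κ_n, λ_n)` from any
constant `c` is controlled by partial sums of `shifted F c` over runs. -/
lemma IsTrajectory.abs_average_sub_le {γ : ℝ} {x : ℕ → Fin 2} {m : ℕ → ℕ}
    (h : IsTrajectory x m) {n : ℕ} (hpos : 0 < lam γ x n) (hpsi : psi x ≤ lam γ x n)
    (hcount : (lam γ x n : ℝ) ^ (1 - γ) ≤ (count x (psi x) (lam γ x n) : ℝ))
    (F : ℕ → ℝ) (c δ : ℝ)
    (hbd : ∀ t ≤ lam γ x n,
      |runSum (shifted F c (tau x (lam γ x n))) m t| ≤ δ * (lam γ x n : ℝ) ^ (1 - γ)) :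
    |1 / (sampleSize γ x n : ℝ) * (∑ i ∈ Finset.Ico (kappa γ x n) (lam γ x n),
      if tau x i = tau x (lam γ x n) then F (sigma x i) else 0) - c| ≤ 2 * δ := by
  set k := lam γ x n with hk
  set L := tau x k with hL
  have hkpow : 0 < (k : ℝ) ^ (1 - γ) := Real.rpow_pos_of_pos (by exact_mod_cast hpos) _
  have hs1 : 1 ≤ sampleSize γ x n := Nat.ceil_pos.2 hkpow
  have hs2 : sampleSize γ x n ≤ count x (psi x) k := Nat.ceil_le.2 hcount
  have hs3 : (k : ℝ) ^ (1 - γ) ≤ (sampleSize γ x n : ℝ) := Nat.le_ceil _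
  obtain ⟨K, hK1, hK2, hK3, hK4⟩ := isGreatest_window hs1 hs2 hpsi
  have hkap : kappa γ x n = K := hK1.csSup_eq
  have hLK : L ≤ K := by rw [hL, ← hK4]; exact h.tau_le hK3
  set s : ℝ := (sampleSize γ x n : ℝ) with hs
  have hspos : 0 < s := by rw [hs]; exact_mod_cast hs1
  have hcard : ∑ i ∈ Finset.Ico K k, (if tau x i = L then (c : ℝ) else 0) = s * c := by
    rw [← Finset.sum_filter, Finset.sum_const, nsmul_eq_mul]
    congr 1
    have : count x K k = sampleSize γ x n := hK1.1
    rw [hs, ← this, count]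
    congr 2
    apply Finset.filter_congr
    intro i hi
    have := (Finset.mem_Ico.1 hi).1
    simp only [hL]
    constructor
    · intro h'; exact ⟨by omega, h'⟩
    · exact fun h' => h'.2
  have hdiff : (∑ i ∈ Finset.Ico K k, if tau x i = L then F (sigma x i) else 0) - s * c =
      runSum (shifted F c L) m (k - L) - runSum (shifted F c L) m (K - L) := by
    have := h.sum_window (fun a => F a - c) hK3 hLK hK2.le
    rw [show shifted F c L = fun r => if L ≤ r then F (r - L) - c else 0 from rfl, ← this, ← hcard,
      ← Finset.sum_sub_distrib]
    refine Finset.sum_congr rfl fun i _ => ?_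
    split_ifs <;> simp
  rw [hkap]
  have e1 : 1 / s * (∑ i ∈ Finset.Ico K k, if tau x i = L then F (sigma x i) else 0) - c =
      (runSum (shifted F c L) m (k - L) - runSum (shifted F c L) m (K - L)) / s := by
    rw [← hdiff]; field_simp
  rw [e1, abs_div, abs_of_pos hspos, div_le_iff₀ hspos]
  have b1 := hbd (k - L) (Nat.sub_le _ _)
  have b2 := hbd (K - L) (by omega)
  have b3 := abs_sub (runSum (shifted F c L) m (k - L)) (runSum (shifted F c L) m (K - L))
  have hδ : 0 ≤ δ := by
    have := (abs_nonneg _).trans b1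
    exact nonneg_of_mul_nonneg_left this hkpow
  have : 2 * δ * (k : ℝ) ^ (1 - γ) ≤ 2 * δ * s := by gcongr
  linarith

/-! ### Runs are independent of the past -/

/-- The run length distribution as a measure on `ℕ`. -/
def runLaw (p : ℕ → ℝ) : Measure ℕ :=
  Measure.sum fun r => ENNReal.ofReal (p r) • Measure.dirac r

lemma runLaw_singleton (p : ℕ → ℝ) (r : ℕ) : runLaw p {r} = ENNReal.ofReal (p r) := by
  rw [runLaw, Measure.sum_apply _ (measurableSet_singleton r), tsum_eq_single r]
  · simp
  · intro b hb
    simp [hb]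

lemma isProbabilityMeasure_runLaw {p : ℕ → ℝ} (hp : ∀ k, 0 ≤ p k) (hp1 : HasSum p 1) :
    IsProbabilityMeasure (runLaw p) := by
  constructor
  rw [runLaw, Measure.sum_apply _ MeasurableSet.univ]
  simp only [Measure.smul_apply, measure_univ, smul_eq_mul, mul_one]
  rw [← ENNReal.ofReal_tsum_of_nonneg hp hp1.summable, hp1.tsum_eq, ENNReal.ofReal_one]

lemma integrable_runLaw {p : ℕ → ℝ} (hp : ∀ k, 0 ≤ p k) {f : ℕ → ℝ}
    (hf : Summable fun r => p r * f r) : Integrable f (runLaw p) := by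
  refine ⟨(measurable_of_countable f).aestronglyMeasurable, ?_⟩
  rw [HasFiniteIntegral, runLaw, lintegral_sum_measure]
  have h1 : ∀ r, ∫⁻ a, ‖f a‖ₑ ∂(ENNReal.ofReal (p r) • Measure.dirac r) =
      ENNReal.ofReal ‖p r * f r‖ := by
    intro r
    rw [lintegral_smul_measure, lintegral_dirac, norm_mul, Real.norm_of_nonneg (hp r),
      ENNReal.ofReal_mul (hp r), ofReal_norm]
    rfl
  simp only [h1]
  rw [← ENNReal.ofReal_tsum_of_nonneg (fun _ => norm_nonneg _) hf.norm]
  exact ENNReal.ofReal_lt_top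

lemma integral_runLaw {p : ℕ → ℝ} (hp : ∀ k, 0 ≤ p k) {f : ℕ → ℝ}
    (hf : Summable fun r => p r * f r) : ∫ r, f r ∂(runLaw p) = ∑' r, p r * f r := by
  rw [integral_countable (integrable_runLaw hp hf)]
  refine tsum_congr fun r => ?_
  rw [measureReal_def, runLaw_singleton, ENNReal.toReal_ofReal (hp r), smul_eq_mul]

/-- The first `t + 1` values of a sequence. -/
def history {Ω β : Type*} (Y : ℕ → Ω → β) (t : ℕ) (ω : Ω) : Fin (t + 1) → β := fun i => Y i ω

/-- Extension of a finite sequence by a constant. -/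
def extend {β : Type*} (b : β) {t : ℕ} (h : Fin (t + 1) → β) (i : ℕ) : β :=
  if hi : i < t + 1 then h ⟨i, hi⟩ else b

lemma extend_history {Ω β : Type*} (Y : ℕ → Ω → β) (b : β) {t i : ℕ} (hi : i ≤ t) (ω : Ω) :
    extend b (history Y t ω) i = Y i ω := by
  rw [extend, dif_pos (by omega)]; rfl

lemma measurable_history {Ω β : Type*} [MeasurableSpace Ω] [MeasurableSpace β] {Y : ℕ → Ω → β}
    (hY : ∀ n, Measurable (Y n)) (t : ℕ) : Measurable (history Y t) :=
  measurable_pi_lambda _ fun i => hY i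

section Chain

variable {Ω : Type*} [MeasurableSpace Ω] {P : Measure Ω}
  {p : ℕ → ℝ} {M : ℕ → Ω → ℕ}

lemma measurableSet_zero (hM : IsStationaryChain P p M) (t : ℕ) :
    MeasurableSet {ω | M t ω = 0} :=
  hM.measurable t (measurableSet_singleton 0)

/-- On the event that the chain is at `0` at time `t`, its next position is independent of the
past and has law `p`. -/
lemma map_history_next [IsProbabilityMeasure P] (hp : ∀ k, 0 ≤ p k) (hp1 : HasSum p 1) (hM : IsStationaryChain P p M)
    (t : ℕ) :
    (P.restrict {ω | M t ω = 0}).map (fun ω => (history M t ω, M (t + 1) ω)) =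
      ((P.restrict {ω | M t ω = 0}).map (history M t)).prod (runLaw p) := by
  have := isProbabilityMeasure_runLaw hp hp1
  have hmh := measurable_history hM.measurable t
  have hm := hmh.prodMk (hM.measurable (t + 1))
  refine Measure.ext_of_singleton fun ⟨h, r⟩ => ?_
  rw [Measure.map_apply hm (measurableSet_singleton _),
    Measure.restrict_apply (hm (measurableSet_singleton _)),
    ← Set.singleton_prod_singleton, Measure.prod_prod,
    Measure.map_apply hmh (measurableSet_singleton _),
    Measure.restrict_apply (hmh (measurableSet_singleton _)), runLaw_singleton]
  set s : ℕ → ℕ := fun i => if i = t + 1 then r else extend 0 h i with hs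
  have hs1 : s (t + 1) = r := by simp [hs]
  have hs2 : ∀ i : Fin (t + 1), s i = h i := by
    intro i
    have := i.2
    simp only [hs]
    rw [if_neg (by omega), extend, dif_pos this]
  have hhist : ∀ ω, history M t ω = h ↔ ∀ i ≤ t, M i ω = s i := by
    intro ω
    constructor
    · rintro hω i hi
      have := congrFun hω ⟨i, by omega⟩
      rw [← hs2] at this
      exact this
    · intro hω
      ext i
      rw [← hs2]
      exact hω i (by omega)
  by_cases h0 : s t = 0
  · have e1 : history M t ⁻¹' {h} ∩ {ω | M t ω = 0} = {ω | ∀ i ≤ t, M i ω = s i} := by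
      ext ω
      simp only [Set.mem_inter_iff, Set.mem_preimage, Set.mem_singleton_iff, hhist,
        Set.mem_ofPred_eq]
      exact ⟨fun h => h.1, fun h => ⟨h, (h t le_rfl).trans h0⟩⟩
    have e2 : (fun ω => (history M t ω, M (t + 1) ω)) ⁻¹' ({h} ×ˢ {r}) ∩ {ω | M t ω = 0} =
        {ω | ∀ i ≤ t + 1, M i ω = s i} := by
      ext ω
      simp only [Set.mem_inter_iff, Set.mem_preimage, Set.mem_prod, Set.mem_singleton_iff, hhist,
        Set.mem_ofPred_eq]
      constructor
      · rintro ⟨⟨a, b⟩, -⟩ i hi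
        rcases Nat.le_succ_iff.1 hi with hi | rfl
        · exact a i hi
        · rw [hs1, b]
      · intro a
        exact ⟨⟨fun i hi => a i (by omega), by rw [a _ le_rfl, hs1]⟩, (a t (by omega)).trans h0⟩
    rw [e1, e2, ← ofReal_measureReal, ← ofReal_measureReal, hM.markov (t + 1) s, hM.markov t s,
      Finset.prod_range_succ, hs1, h0, ← mul_assoc, transProb, ENNReal.ofReal_mul' (hp r)]
  · have e1 : ∀ A : Set Ω, A ⊆ history M t ⁻¹' {h} → A ∩ {ω | M t ω = 0} = ∅ := by
      intro A hA
      ext ω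
      simp only [Set.mem_inter_iff, Set.mem_ofPred_eq, Set.mem_empty_iff_false, iff_false, not_and]
      intro hω hω0
      exact h0 (((hhist ω).1 (hA hω) t le_rfl).symm.trans hω0)
    rw [e1 _ subset_rfl, e1]
    · simp
    · intro ω hω
      exact hω.1

/-- The filtration generated by the chain: at time `t` it is generated by `M_0, …, M_t`. -/
def chainFiltration (hM : IsStationaryChain P p M) : Filtration ℕ ‹MeasurableSpace Ω› where
  seq t := MeasurableSpace.comap (history M t) inferInstance
  mono' s t hst := by
    apply Measurable.comap_le
    refine @measurable_pi_lambda _ _ _ (MeasurableSpace.comap (history M t) inferInstance) _ _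
      fun i => ?_
    have h1 : (fun ω => history M s ω i) =
        (fun h : Fin (t + 1) → ℕ => h ⟨i, by omega⟩) ∘ history M t := rfl
    rw [h1]
    exact (measurable_pi_apply _).comp (comap_measurable _)
  le' t := (measurable_history hM.measurable t).comap_le

lemma runSum_succ (f : ℕ → ℝ) (m : ℕ → ℕ) (t : ℕ) :
    runSum f m (t + 1) = runSum f m t + if m t = 0 then f (m (t + 1)) else 0 :=
  Finset.sum_range_succ _ _

lemma runSum_congr (f : ℕ → ℝ) {m m' : ℕ → ℕ} {t : ℕ} (h : ∀ i ≤ t, m i = m' i) :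
    runSum f m t = runSum f m' t := by
  refine Finset.sum_congr rfl fun z hz => ?_
  have := Finset.mem_range.1 hz
  rw [h z (by omega), h (z + 1) (by omega)]

lemma runSum_history {Ω : Type*} {M : ℕ → Ω → ℕ} (f : ℕ → ℝ) (t : ℕ) (ω : Ω) :
    runSum f (extend 0 (history M t ω)) t = runSum f (fun i => M i ω) t :=
  runSum_congr f fun _ hi => extend_history M 0 hi ω

lemma measurable_runSum (hM : IsStationaryChain P p M) (f : ℕ → ℝ) (t : ℕ) :
    Measurable[chainFiltration hM t] fun ω => runSum f (fun i => M i ω) t := by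
  simp_rw [← runSum_history f t]
  exact (measurable_of_countable fun h : Fin (t + 1) → ℕ => runSum f (extend 0 h) t).comp
    (comap_measurable _)

variable [IsProbabilityMeasure P]

/-- `∫ 1_{M_t = 0} G(M_0, …, M_t) f(M_{t+1})` factorizes. -/
lemma integral_history_mul_next (hp : ∀ k, 0 ≤ p k) (hp1 : HasSum p 1)
    (hM : IsStationaryChain P p M) (t : ℕ) (G : (Fin (t + 1) → ℕ) → ℝ) (f : ℕ → ℝ) :
    ∫ ω, (if M t ω = 0 then G (history M t ω) * f (M (t + 1) ω) else 0) ∂P =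
      (∫ ω, (if M t ω = 0 then G (history M t ω) else 0) ∂P) * ∫ r, f r ∂(runLaw p) := by
  have := isProbabilityMeasure_runLaw hp hp1
  have hmh := measurable_history hM.measurable t
  have hm := hmh.prodMk (hM.measurable (t + 1))
  have hset := measurableSet_zero hM t
  have h1 : ∀ g : Ω → ℝ, ∫ ω, (if M t ω = 0 then g ω else 0) ∂P =
      ∫ ω in {ω | M t ω = 0}, g ω ∂P := by
    intro g
    rw [← integral_indicator hset]
    simp only [Set.indicator_apply, Set.mem_ofPred_eq]
  rw [h1, h1, ← integral_map hmh.aemeasurable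
    (measurable_of_countable G).aestronglyMeasurable, ← integral_prod_mul,
    ← map_history_next hp hp1 hM t, integral_map hm.aemeasurable]
  exact (measurable_of_countable _).aestronglyMeasurable

lemma integrable_next (hp : ∀ k, 0 ≤ p k) (hp1 : HasSum p 1)
    (hM : IsStationaryChain P p M) (t : ℕ) {f : ℕ → ℝ} (hf : Integrable f (runLaw p)) :
    Integrable (fun ω => if M t ω = 0 then f (M (t + 1) ω) else 0) P := by
  have := isProbabilityMeasure_runLaw hp hp1
  have hmh := measurable_history hM.measurable t
  have hm := hmh.prodMk (hM.measurable (t + 1))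
  have hset := measurableSet_zero hM t
  have h1 : (fun ω => if M t ω = 0 then f (M (t + 1) ω) else 0) =
      {ω | M t ω = 0}.indicator (fun ω => f (M (t + 1) ω)) := by
    ext ω
    simp only [Set.indicator_apply, Set.mem_ofPred_eq]
  rw [h1, integrable_indicator_iff hset, IntegrableOn]
  have h2 := hf.comp_snd ((P.restrict {ω | M t ω = 0}).map (history M t))
  rw [← map_history_next hp hp1 hM t] at h2
  exact (integrable_map_measure (measurable_of_countable _).aestronglyMeasurable
    hm.aemeasurable).1 h2

/-! ### A maximal inequality for sums over runs -/

section Centered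

variable {f : ℕ → ℝ}

lemma memLp_increment (hp : ∀ k, 0 ≤ p k) (hp1 : HasSum p 1) (hM : IsStationaryChain P p M)
    (hf2 : Summable fun r => p r * f r ^ 2) (t : ℕ) :
    MemLp (fun ω => if M t ω = 0 then f (M (t + 1) ω) else 0) 2 P := by
  have hmeas : Measurable fun ω => if M t ω = 0 then f (M (t + 1) ω) else 0 :=
    Measurable.ite (measurableSet_zero hM t)
      ((measurable_of_countable f).comp (hM.measurable (t + 1))) measurable_const
  rw [memLp_two_iff_integrable_sq hmeas.aestronglyMeasurable]
  refine (integrable_next hp hp1 hM t (integrable_runLaw hp hf2)).congr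
    (Eventually.of_forall fun ω => ?_)
  simp only
  split_ifs <;> simp

lemma memLp_runSum (hp : ∀ k, 0 ≤ p k) (hp1 : HasSum p 1) (hM : IsStationaryChain P p M)
    (hf2 : Summable fun r => p r * f r ^ 2) (t : ℕ) :
    MemLp (fun ω => runSum f (fun i => M i ω) t) 2 P :=
  memLp_finsetSum _ fun z _ => memLp_increment hp hp1 hM hf2 z

/-- The increments of `runSum f` are orthogonal to the past if `f` is centered. -/
lemma setIntegral_runSum_mul_increment (hp : ∀ k, 0 ≤ p k) (hp1 : HasSum p 1)
    (hM : IsStationaryChain P p M) (hf : HasSum (fun r => p r * f r) 0) (t : ℕ) {A : Set Ω}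
    (hA : MeasurableSet[chainFiltration hM t] A) :
    ∫ ω in A, runSum f (fun i => M i ω) t *
      (if M t ω = 0 then f (M (t + 1) ω) else 0) ∂P = 0 := by
  have hA' := (chainFiltration hM).le t A hA
  obtain ⟨S, -, rfl⟩ := hA
  have h := integral_history_mul_next hp hp1 hM t
    (S.indicator fun h => runSum f (extend 0 h) t) f
  rw [integral_runLaw hp hf.summable, hf.tsum_eq, mul_zero] at h
  rw [← integral_indicator hA']
  refine Eq.trans ?_ h
  congr 1
  ext ω
  by_cases hω : history M t ω ∈ S
  · have h1 : ω ∈ history M t ⁻¹' S := hω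
    rw [Set.indicator_of_mem hω, Set.indicator_of_mem h1, runSum_history]
    split_ifs <;> simp
  · have h1 : ω ∉ history M t ⁻¹' S := hω
    rw [Set.indicator_of_notMem hω, Set.indicator_of_notMem h1]
    simp

lemma setIntegral_runSum_sq_succ (hp : ∀ k, 0 ≤ p k) (hp1 : HasSum p 1)
    (hM : IsStationaryChain P p M) (hf : HasSum (fun r => p r * f r) 0)
    (hf2 : Summable fun r => p r * f r ^ 2) (t : ℕ) {A : Set Ω}
    (hA : MeasurableSet[chainFiltration hM t] A) :
    ∫ ω in A, runSum f (fun i => M i ω) (t + 1) ^ 2 ∂P =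
      ∫ ω in A, runSum f (fun i => M i ω) t ^ 2 ∂P +
        ∫ ω in A, (if M t ω = 0 then f (M (t + 1) ω) else 0) ^ 2 ∂P := by
  have hW := memLp_runSum hp hp1 hM hf2 t
  have hI := memLp_increment hp hp1 hM hf2 t
  have h0 := setIntegral_runSum_mul_increment hp hp1 hM hf t hA
  have i1 := hW.integrable_sq.restrict (s := A)
  have i2 := hI.integrable_sq.restrict (s := A)
  have i3 : Integrable (fun ω => runSum f (fun i => M i ω) t *
      (if M t ω = 0 then f (M (t + 1) ω) else 0)) (P.restrict A) :=
    (hW.integrable_mul hI).restrict (s := A)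
  calc _ = ∫ ω in A, (runSum f (fun i => M i ω) t ^ 2 +
        (if M t ω = 0 then f (M (t + 1) ω) else 0) ^ 2) +
        2 * (runSum f (fun i => M i ω) t * (if M t ω = 0 then f (M (t + 1) ω) else 0)) ∂P := by
          congr 1; ext ω; rw [runSum_succ]; ring
    _ = _ := by
      have e1 := integral_add (i1.add i2) (i3.const_mul 2)
      have e2 := integral_add i1 i2
      rw [integral_const_mul, h0] at e1
      simp only [Pi.add_apply, mul_zero, add_zero] at e1
      exact e1.trans e2

lemma submartingale_runSum_sq (hp : ∀ k, 0 ≤ p k) (hp1 : HasSum p 1)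
    (hM : IsStationaryChain P p M) (hf : HasSum (fun r => p r * f r) 0)
    (hf2 : Summable fun r => p r * f r ^ 2) :
    Submartingale (fun t ω => runSum f (fun i => M i ω) t ^ 2) (chainFiltration hM) P := by
  refine submartingale_of_setIntegral_le_succ
    (fun t => ((measurable_runSum hM f t).pow_const 2).stronglyMeasurable)
    (fun t => (memLp_runSum hp hp1 hM hf2 t).integrable_sq) fun t A hA => ?_
  rw [setIntegral_runSum_sq_succ hp hp1 hM hf hf2 t hA]
  have : 0 ≤ ∫ ω in A, (if M t ω = 0 then f (M (t + 1) ω) else 0) ^ 2 ∂P :=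
    integral_nonneg fun _ => sq_nonneg _
  linarith

lemma integral_runSum_sq_le (hp : ∀ k, 0 ≤ p k) (hp1 : HasSum p 1)
    (hM : IsStationaryChain P p M) (hf : HasSum (fun r => p r * f r) 0)
    (hf2 : Summable fun r => p r * f r ^ 2) (t : ℕ) :
    ∫ ω, runSum f (fun i => M i ω) t ^ 2 ∂P ≤ t * ∑' r, p r * f r ^ 2 := by
  induction t with
  | zero => simp [runSum]
  | succ t ih =>
    have h1 := setIntegral_runSum_sq_succ hp hp1 hM hf hf2 t MeasurableSet.univ
    simp only [setIntegral_univ] at h1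
    have h2 := integral_history_mul_next hp hp1 hM t (fun _ => 1) fun r => f r ^ 2
    rw [integral_runLaw hp hf2] at h2
    have h3 : ∫ ω, (if M t ω = 0 then f (M (t + 1) ω) else 0) ^ 2 ∂P =
        ∫ ω, (if M t ω = 0 then 1 * f (M (t + 1) ω) ^ 2 else 0) ∂P := by
      congr 1; ext ω; split_ifs <;> simp
    have h4 : ∫ ω, (if M t ω = 0 then (1 : ℝ) else 0) ∂P ≤ 1 := by
      have : ∫ ω, (if M t ω = 0 then (1 : ℝ) else 0) ∂P = P.real {ω | M t ω = 0} := by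
        rw [← integral_indicator_one (measurableSet_zero hM t)]
        simp only [Set.indicator_apply, Set.mem_ofPred_eq, Pi.one_apply]
      rw [this]
      exact measureReal_le_one
    have h5 : 0 ≤ ∑' r, p r * f r ^ 2 := tsum_nonneg fun r => mul_nonneg (hp r) (sq_nonneg _)
    rw [h1, h3, h2]
    push_cast
    nlinarith

/-- Kolmogorov's maximal inequality for sums over runs. -/
lemma measure_exists_runSum_ge_le (hp : ∀ k, 0 ≤ p k) (hp1 : HasSum p 1)
    (hM : IsStationaryChain P p M) (hf : HasSum (fun r => p r * f r) 0)
    (hf2 : Summable fun r => p r * f r ^ 2) (n : ℕ) {a : ℝ} (ha : 0 < a) :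
    P {ω | ∃ t ≤ n, a ≤ |runSum f (fun i => M i ω) t|} ≤
      ENNReal.ofReal (n * (∑' r, p r * f r ^ 2) / a ^ 2) := by
  set ε : NNReal := ⟨a ^ 2, sq_nonneg a⟩ with hε
  have h1 := maximal_ineq (submartingale_runSum_sq hp hp1 hM hf hf2)
    (fun t ω => sq_nonneg _) (ε := ε) n
  have hset : {ω | ∃ t ≤ n, a ≤ |runSum f (fun i => M i ω) t|} =
      {ω | (ε : ℝ) ≤ (Finset.range (n + 1)).sup' Finset.nonempty_range_add_one
        fun k => runSum f (fun i => M i ω) k ^ 2} := by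
    ext ω
    simp only [Set.mem_ofPred_eq, Finset.le_sup'_iff, Finset.mem_range, Nat.lt_succ_iff]
    refine exists_congr fun t => and_congr_right fun _ => ?_
    rw [← sq_abs (runSum f _ t)]
    exact (pow_le_pow_iff_left₀ ha.le (abs_nonneg _) two_ne_zero).symm
  rw [← hset] at h1
  have h2 : ∫ ω in {ω | ∃ t ≤ n, a ≤ |runSum f (fun i => M i ω) t|},
      runSum f (fun i => M i ω) n ^ 2 ∂P ≤ n * ∑' r, p r * f r ^ 2 :=
    (setIntegral_le_integral (memLp_runSum hp hp1 hM hf2 n).integrable_sq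
      (Eventually.of_forall fun ω => sq_nonneg _)).trans
      (integral_runSum_sq_le hp hp1 hM hf hf2 n)
  have h3 := h1.trans (ENNReal.ofReal_le_ofReal h2)
  rw [ENNReal.ofReal_div_of_pos (pow_pos ha 2), ENNReal.le_div_iff_mul_le, mul_comm]
  · refine le_of_eq_of_le ?_ h3
    congr 1
    rw [hε, ENNReal.ofReal_eq_coe_nnreal (sq_nonneg a)]
    rfl
  · left
    simpa using ha.ne'
  · left
    exact ENNReal.ofReal_ne_top

end Centered

/-- A uniform law of large numbers, with a rate: simultaneously for countably many centered
functions with summable variances, the sums over the runs before time `k` are `o(k ^ (1 - γ))`. -/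
theorem ae_eventually_abs_runSum_le (hp : ∀ k, 0 ≤ p k) (hp1 : HasSum p 1)
    (hM : IsStationaryChain P p M) {ι : Type*} [Countable ι] {f : ι → ℕ → ℝ}
    (hf : ∀ i, HasSum (fun r => p r * f i r) 0) (hf2 : ∀ i, Summable fun r => p r * f i r ^ 2)
    (hsum : Summable fun i => ∑' r, p r * f i r ^ 2) {γ : ℝ} (hγ : γ < 1 / 2) :
    ∀ᵐ ω ∂P, ∀ ε : ℝ, 0 < ε → ∀ᶠ k : ℕ in atTop, ∀ i, ∀ t ≤ k,
      |runSum (f i) (fun n => M n ω) t| ≤ ε * (k : ℝ) ^ (1 - γ) := by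
  -- Along dyadic times the maximal inequality gives a geometrically decaying bound.
  have key : ∀ q : ℕ, ∀ᵐ ω ∂P, ∀ᶠ r : ℕ in atTop, ω ∉ ⋃ i, {ω | ∃ t ≤ 2 ^ (r + 1),
      1 / ((q : ℝ) + 1) * ((2 : ℝ) ^ r) ^ (1 - γ) ≤ |runSum (f i) (fun n => M n ω) t|} := by
    intro q
    apply ae_eventually_notMem
    set V : ι → ℝ := fun i => ∑' r, p r * f i r ^ 2 with hV
    have hV0 : ∀ i, 0 ≤ V i := fun i => tsum_nonneg fun r => mul_nonneg (hp r) (sq_nonneg _)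
    set ρ : ℝ := (2 : ℝ) ^ (2 * γ - 1) with hρ
    have hρ1 : ρ < 1 := Real.rpow_lt_one_of_one_lt_of_neg (by norm_num) (by linarith)
    have hρ0 : 0 ≤ ρ := by positivity
    have hb : ∀ r : ℕ, P (⋃ i, {ω | ∃ t ≤ 2 ^ (r + 1),
        1 / ((q : ℝ) + 1) * ((2 : ℝ) ^ r) ^ (1 - γ) ≤ |runSum (f i) (fun n => M n ω) t|}) ≤
        ENNReal.ofReal ((∑' i, V i) * (2 * ((q : ℝ) + 1) ^ 2) * ρ ^ r) := by
      intro r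
      have hx : (0 : ℝ) < (2 : ℝ) ^ r := by positivity
      have ha : 0 < 1 / ((q : ℝ) + 1) * ((2 : ℝ) ^ r) ^ (1 - γ) := by positivity
      have heq : ∀ i, ((2 ^ (r + 1) : ℕ) : ℝ) * V i /
          (1 / ((q : ℝ) + 1) * ((2 : ℝ) ^ r) ^ (1 - γ)) ^ 2 =
          V i * ((2 * ((q : ℝ) + 1) ^ 2) * ρ ^ r) := by
        intro i
        have e1 : ρ ^ r = ((2 : ℝ) ^ r) ^ (2 * γ - 1) := by
          rw [hρ, ← Real.rpow_natCast, ← Real.rpow_natCast, ← Real.rpow_mul (by norm_num),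
            ← Real.rpow_mul (by norm_num), mul_comm]
        have e2 : (((2 : ℝ) ^ r) ^ (1 - γ)) ^ 2 * ((2 : ℝ) ^ r) ^ (2 * γ - 1) = (2 : ℝ) ^ r := by
          rw [← Real.rpow_natCast (((2 : ℝ) ^ r) ^ (1 - γ)), ← Real.rpow_mul hx.le,
            ← Real.rpow_add hx]
          conv_rhs => rw [← Real.rpow_one ((2 : ℝ) ^ r)]
          congr 1
          push_cast
          ring
        rw [e1, div_eq_iff (by positivity)]
        push_cast
        rw [pow_succ]
        calc (2 : ℝ) ^ r * 2 * V i = ((((2 : ℝ) ^ r) ^ (1 - γ)) ^ 2 *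
              ((2 : ℝ) ^ r) ^ (2 * γ - 1)) * 2 * V i := by rw [e2]
          _ = _ := by field_simp
      refine (measure_iUnion_le _).trans ((ENNReal.tsum_le_tsum fun i =>
        measure_exists_runSum_ge_le hp hp1 hM (hf i) (hf2 i) (2 ^ (r + 1)) ha).trans ?_)
      have heq' := fun i => congrArg ENNReal.ofReal (heq i)
      simp only [hV] at heq' hV0 ⊢
      simp only [heq']
      rw [← ENNReal.ofReal_tsum_of_nonneg
        (fun i => mul_nonneg (hV0 i) (by positivity)) (hsum.mul_right _), tsum_mul_right,
        ← mul_assoc]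
    refine ne_top_of_le_ne_top ?_ (ENNReal.tsum_le_tsum hb)
    have hg : Summable fun r : ℕ => (∑' i, V i) * (2 * ((q : ℝ) + 1) ^ 2) * ρ ^ r :=
      (summable_geometric_of_lt_one hρ0 hρ1).mul_left _
    rw [← ENNReal.ofReal_tsum_of_nonneg _ hg]
    · exact ENNReal.ofReal_ne_top
    · intro r
      have : 0 ≤ ∑' i, V i := tsum_nonneg hV0
      positivity
  filter_upwards [ae_all_iff.2 key] with ω hω ε hε
  obtain ⟨q, hq⟩ := exists_nat_one_div_lt hε
  have hlog : Tendsto (fun k => Nat.log 2 k) atTop atTop :=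
    tendsto_atTop_atTop.2 fun b => ⟨2 ^ b, fun k hk => Nat.le_log_of_pow_le (by norm_num) hk⟩
  filter_upwards [hlog.eventually (hω q), eventually_gt_atTop 0] with k hk hk0 i t ht
  by_contra! hcon
  apply hk
  rw [Set.mem_iUnion]
  refine ⟨i, t, ht.trans (Nat.lt_pow_succ_log_self (by norm_num) k).le, hcon.le.trans' ?_⟩
  have h1 : ((2 : ℝ) ^ Nat.log 2 k) ≤ k := by exact_mod_cast Nat.pow_log_le_self 2 hk0.ne'
  gcongr
  linarith

end Chain

/-! ### Conditional means and moments of run lengths -/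

/-- The conditional mean of `F (R - L)` given `R ≥ L`, where `R` has law `p`. If `R ≥ L` has
probability zero, the value is `0`. -/
def condMean (p : ℕ → ℝ) (F : ℕ → ℝ) (L : ℕ) : ℝ :=
  (∑' l, p (l + L) * F l) / ∑' i, p (i + L)

lemma summable_tail_iff (p F : ℕ → ℝ) (L : ℕ) :
    (Summable fun r => p r * if L ≤ r then F (r - L) else 0) ↔
      Summable fun l => p (l + L) * F l := by
  rw [← (add_left_injective L).summable_iff]
  · refine summable_congr fun l => ?_
    simp
  · intro r hr
    rw [if_neg, mul_zero]
    intro h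
    exact hr ⟨r - L, Nat.sub_add_cancel h⟩

lemma tsum_tail (p F : ℕ → ℝ) (L : ℕ) :
    (∑' r, p r * if L ≤ r then F (r - L) else 0) = ∑' l, p (l + L) * F l := by
  rw [← (add_left_injective L).tsum_eq]
  · refine tsum_congr fun l => ?_
    simp
  · intro r hr
    by_contra h
    apply hr
    simp only
    rw [if_neg, mul_zero]
    intro h'
    exact h ⟨r - L, Nat.sub_add_cancel h'⟩

lemma condMean_mul {p : ℕ → ℝ} (hp : ∀ k, 0 ≤ p k) (hs : Summable p) (F : ℕ → ℝ) (L : ℕ) :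
    condMean p F L * ∑' i, p (i + L) = ∑' l, p (l + L) * F l := by
  by_cases h : ∑' i, p (i + L) = 0
  · have h1 := (hasSum_zero_iff_of_nonneg (fun i => hp (i + L))).1
      (h ▸ ((summable_nat_add_iff L).2 hs).hasSum)
    have h2 : ∀ l, p (l + L) = 0 := fun l => congrFun h1 l
    simp [h2]
  · rw [condMean, div_mul_cancel₀ _ h]

lemma summable_of_summable_sq {p : ℕ → ℝ} (hp : ∀ k, 0 ≤ p k) (hs : Summable p) {F : ℕ → ℝ}
    {L : ℕ} (hF2 : Summable fun l => p (l + L) * F l ^ 2) :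
    Summable fun l => p (l + L) * F l := by
  refine Summable.of_norm_bounded (((summable_nat_add_iff L).2 hs).add hF2) fun l => ?_
  rw [Real.norm_eq_abs, abs_mul, abs_of_nonneg (hp _)]
  nlinarith [hp (l + L), sq_abs (F l), sq_nonneg (|F l| - 1), sq_nonneg (F l)]

lemma hasSum_shifted {p : ℕ → ℝ} (hp : ∀ k, 0 ≤ p k) (hs : Summable p) {F : ℕ → ℝ} {L : ℕ}
    (hF : Summable fun l => p (l + L) * F l) :
    HasSum (fun r => p r * shifted F (condMean p F L) L r) 0 := by
  have hsL := (summable_nat_add_iff L).2 hs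
  have h1 : Summable fun l => p (l + L) * (F l - condMean p F L) := by
    simp_rw [mul_sub]
    exact hF.sub (hsL.mul_right _)
  have h2 := (summable_tail_iff p (fun a => F a - condMean p F L) L).2 h1
  have h3 := tsum_tail p (fun a => F a - condMean p F L) L
  have h4 : ∑' l, p (l + L) * (F l - condMean p F L) = 0 := by
    simp_rw [mul_sub]
    rw [hF.tsum_sub (hsL.mul_right _), tsum_mul_right, ← condMean_mul hp hs]
    ring
  rw [h4] at h3
  exact h3 ▸ h2.hasSum

lemma shifted_sq (F : ℕ → ℝ) (c : ℝ) (L r : ℕ) :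
    shifted F c L r ^ 2 = if L ≤ r then (fun a => (F a - c) ^ 2) (r - L) else 0 := by
  unfold shifted
  split_ifs <;> simp

/-- Centering does not increase the second moment. -/
lemma variance_shifted_le {p : ℕ → ℝ} (hp : ∀ k, 0 ≤ p k) (hs : Summable p) {F : ℕ → ℝ} {L : ℕ}
    (hF2 : Summable fun l => p (l + L) * F l ^ 2) :
    (Summable fun r => p r * shifted F (condMean p F L) L r ^ 2) ∧
      ∑' r, p r * shifted F (condMean p F L) L r ^ 2 ≤ ∑' l, p (l + L) * F l ^ 2 := by
  have hsL := (summable_nat_add_iff L).2 hs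
  have hF := summable_of_summable_sq hp hs hF2
  set c := condMean p F L with hc
  have hexp : ∀ l, p (l + L) * (F l - c) ^ 2 =
      p (l + L) * F l ^ 2 - 2 * c * (p (l + L) * F l) + c ^ 2 * p (l + L) := fun l => by ring
  have h1 : Summable fun l => p (l + L) * (F l - c) ^ 2 := by
    simp_rw [hexp]
    exact (hF2.sub (hF.mul_left _)).add (hsL.mul_left _)
  simp_rw [shifted_sq]
  refine ⟨(summable_tail_iff p (fun a => (F a - c) ^ 2) L).2 h1, ?_⟩
  rw [tsum_tail p (fun a => (F a - c) ^ 2) L]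
  simp_rw [hexp]
  rw [(hF2.sub (hF.mul_left _)).tsum_add (hsL.mul_left _), hF2.tsum_sub (hF.mul_left _),
    tsum_mul_left, tsum_mul_left, ← condMean_mul hp hs F L, ← hc]
  have : 0 ≤ c ^ 2 * ∑' i, p (i + L) := mul_nonneg (sq_nonneg _) (tsum_nonneg fun i => hp _)
  linarith

/-- The uniform law of large numbers for the fluctuations of the estimators: it holds
simultaneously for countably many pairs of a level `L i` and a function `F i`. -/
lemma ae_eventually_abs_runSum_shifted_le {Ω : Type*} [MeasurableSpace Ω] {P : Measure Ω}
    [IsProbabilityMeasure P] {p : ℕ → ℝ} {M : ℕ → Ω → ℕ} (hp : ∀ k, 0 ≤ p k) (hp1 : HasSum p 1)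
    (hM : IsStationaryChain P p M) {ι : Type*} [Countable ι] (F : ι → ℕ → ℝ) (L : ι → ℕ)
    (hF2 : ∀ i, Summable fun l => p (l + L i) * F i l ^ 2)
    (hsum : Summable fun i => ∑' l, p (l + L i) * F i l ^ 2) {γ : ℝ} (hγ : γ < 1 / 2) :
    ∀ᵐ ω ∂P, ∀ ε : ℝ, 0 < ε → ∀ᶠ k : ℕ in atTop, ∀ i, ∀ t ≤ k,
      |runSum (shifted (F i) (condMean p (F i) (L i)) (L i)) (fun n => M n ω) t| ≤
        ε * (k : ℝ) ^ (1 - γ) := by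
  have hv := fun i => variance_shifted_le hp hp1.summable (hF2 i)
  exact ae_eventually_abs_runSum_le hp hp1 hM
    (fun i => hasSum_shifted hp hp1.summable (summable_of_summable_sq hp hp1.summable (hF2 i)))
    (fun i => (hv i).1)
    (Summable.of_nonneg_of_le
      (fun i => tsum_nonneg fun r => mul_nonneg (hp r) (sq_nonneg _)) (fun i => (hv i).2) hsum) hγ

lemma summable_comp_add {q : ℕ → ℝ} (hq : ∀ r, 0 ≤ q r)
    (h : Summable fun r : ℕ => ((r : ℝ) + 1) * q r) :
    Summable fun x : ℕ × ℕ => q (x.2 + x.1) := by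
  rw [← (Finset.HasAntidiagonal.sigmaAntidiagonalEquivProd : _ ≃ ℕ × ℕ).summable_iff, summable_sigma_of_nonneg]
  · refine ⟨fun n => Summable.of_finite, h.congr fun r => ?_⟩
    have h1 : ∀ y : Finset.HasAntidiagonal.antidiagonal r, ((fun x : ℕ × ℕ => q (x.2 + x.1)) ∘
        Finset.HasAntidiagonal.sigmaAntidiagonalEquivProd) ⟨r, y⟩ = q r := by
      rintro ⟨⟨a, b⟩, hab⟩
      rw [Finset.HasAntidiagonal.mem_antidiagonal] at hab
      simp only at hab
      simp [add_comm b a, hab]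
    simp only [h1]
    rw [tsum_fintype]
    simp
  · intro y
    exact hq _

/-- The moment assumption in the form in which it is used. -/
lemma summable_moment {p : ℕ → ℝ} (hp : ∀ k, 0 ≤ p k) (hs : Summable p) {α : ℝ} (hα : 2 < α)
    (hmoment : Summable (fun k : ℕ => (k : ℝ) ^ (α + 1) * p k)) :
    Summable fun x : ℕ × ℕ => p (x.2 + x.1) * ((x.2 : ℝ) + 1) ^ α := by
  have h1 : Summable fun r : ℕ => ((r : ℝ) + 1) * (p r * ((r : ℝ) + 1) ^ α) := by
    refine Summable.of_nonneg_of_le (fun r => ?_) (fun r => ?_)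
      ((hmoment.mul_left ((2 : ℝ) ^ (α + 1))).add hs)
    · have := hp r
      positivity
    · have hr : (0 : ℝ) < (r : ℝ) + 1 := by positivity
      have e1 : ((r : ℝ) + 1) * (p r * ((r : ℝ) + 1) ^ α) = ((r : ℝ) + 1) ^ (α + 1) * p r := by
        rw [Real.rpow_add_one hr.ne']; ring
      have e2 : ((r : ℝ) + 1) ^ (α + 1) ≤ (2 : ℝ) ^ (α + 1) * (r : ℝ) ^ (α + 1) + 1 := by
        rcases Nat.eq_zero_or_pos r with rfl | h0
        · have : (0 : ℝ) ≤ (2 : ℝ) ^ (α + 1) * ((0 : ℕ) : ℝ) ^ (α + 1) := by positivity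
          simpa using this
        · have h2 : (1 : ℝ) ≤ r := by exact_mod_cast h0
          rw [← Real.mul_rpow (by norm_num) (by positivity)]
          have := Real.rpow_le_rpow hr.le (show (r : ℝ) + 1 ≤ 2 * r by linarith)
            (show 0 ≤ α + 1 by linarith)
          linarith
      rw [e1]
      have := mul_le_mul_of_nonneg_right e2 (hp r)
      linarith
  refine Summable.of_nonneg_of_le (fun x => ?_) (fun x => ?_)
    (summable_comp_add (q := fun r => p r * ((r : ℝ) + 1) ^ α) (fun r => ?_) h1)
  · have := hp (x.2 + x.1)
    positivity
  · refine mul_le_mul_of_nonneg_left ?_ (hp _)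
    refine Real.rpow_le_rpow (by positivity) ?_ (by linarith)
    push_cast
    have : (0 : ℝ) ≤ (x.1 : ℝ) := by positivity
    linarith
  · have := hp r
    positivity

/-! ### Trajectories and integrability -/

section Chain

variable {Ω : Type*} [MeasurableSpace Ω] {P : Measure Ω} [IsProbabilityMeasure P]
  {p : ℕ → ℝ} {M : ℕ → Ω → ℕ}

lemma ae_dec (hM : IsStationaryChain P p M) :
    ∀ᵐ ω ∂P, ∀ n k, M n ω = k + 1 → M (n + 1) ω = k := by
  have key : ∀ᵐ ω ∂P, ∀ n, ∀ h : Fin (n + 2) → ℕ, ∀ k, extend 0 h n = k + 1 →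
      extend 0 h (n + 1) ≠ k → history M (n + 1) ω ≠ h := by
    simp only [ae_all_iff]
    intro n h k h1 h2
    rw [ae_iff]
    simp only [not_not]
    have h3 := hM.markov (n + 1) (extend 0 h)
    rw [Finset.prod_range_succ, h1, transProb, if_neg h2, mul_zero, mul_zero,
      measureReal_eq_zero_iff] at h3
    refine measure_mono_null ?_ h3
    intro ω hω i hi
    simp only [Set.mem_ofPred_eq] at hω
    rw [← hω, extend_history M 0 hi]
  filter_upwards [key] with ω hω n k hk
  by_contra h
  refine hω n (history M (n + 1) ω) k ?_ ?_ rfl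
  · rwa [extend_history M 0 (by omega)]
  · rwa [extend_history M 0 (by omega)]

/-- The stationary law is dominated by the tail of the run length distribution. -/
lemma measureReal_le_tail (hp : ∀ k, 0 ≤ p k) (hp1 : HasSum p 1) (hM : IsStationaryChain P p M)
    (n j : ℕ) : P.real {ω | M n ω = j} ≤ ∑' i, p (i + j) := by
  rw [hM.stationary]
  have hstep : ∀ j, P.real {ω | M 0 ω = j} ≤ p j + P.real {ω | M 0 ω = j + 1} := by
    intro j
    rw [← hM.stationary 1 j]
    have h1 : P.real {ω | M 1 ω = j} ≤
        P.real ({ω | ∀ i ≤ 1, M i ω = (fun i => if i = 0 then 0 else j) i} ∪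
          {ω | M 0 ω = j + 1}) := by
      refine ENNReal.toReal_mono (measure_ne_top _ _) (measure_mono_ae ?_)
      filter_upwards [ae_dec hM] with ω hω hj
      change M 1 ω = j at hj
      rcases h0 : M 0 ω with _ | k
      · left
        intro i hi
        interval_cases i
        · simpa using h0
        · simpa using hj
      · right
        have := hω 0 k h0
        change M 0 ω = j + 1
        rw [h0, ← hj, ← this]
    refine h1.trans ((measureReal_union_le _ _).trans ?_)
    rw [hM.markov 1]
    simp only [Finset.prod_range_one, if_true, transProb]
    have h2 : P.real {ω | M 0 ω = 0} ≤ 1 := measureReal_le_one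
    have := mul_le_mul_of_nonneg_right h2 (hp j)
    simp at this ⊢
    linarith
  -- Iterate `π_j ≤ p_j + π_{j+1}` and use `π_j → 0`.
  have hiter : ∀ m, P.real {ω | M 0 ω = j} ≤
      (∑ i ∈ Finset.range m, p (i + j)) + P.real {ω | M 0 ω = j + m} := by
    intro m
    induction m with
    | zero => simp
    | succ m ih =>
      rw [Finset.sum_range_succ]
      have := hstep (j + m)
      rw [add_comm m j]
      rw [add_assoc j m 1] at this
      linarith
  have hlim : Tendsto (fun m => P.real {ω | M 0 ω = j + m}) atTop (𝓝 0) := by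
    have h1 : Summable fun a => (P.map (M 0)).real {a} := by
      have : IsProbabilityMeasure (P.map (M 0)) :=
        Measure.isProbabilityMeasure_map (hM.measurable 0).aemeasurable
      have h2 : Integrable (fun _ : ℕ => (1 : ℝ)) (P.map (M 0)) := integrable_const _
      have h3 := (hasSum_integral_measure (μ := fun a : ℕ => (P.map (M 0)) {a} • Measure.dirac a)
        (f := fun _ => (1 : ℝ)) (by rw [Measure.sum_smul_dirac]; exact h2)).summable
      refine h3.congr fun a => ?_
      simp [measureReal_def]
    have h2 := (h1.tendsto_atTop_zero).comp (tendsto_add_atTop_nat j)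
    refine h2.congr fun m => ?_
    simp only [Function.comp]
    rw [map_measureReal_apply (hM.measurable 0) (measurableSet_singleton _), add_comm m j]
    rfl
  refine ge_of_tendsto' (x := atTop) (f := fun m => (∑ i ∈ Finset.range m, p (i + j)) +
    P.real {ω | M 0 ω = j + m}) ?_ hiter
  simpa using (((summable_nat_add_iff j).2 hp1.summable).hasSum.tendsto_sum_nat).add hlim

/-- The stationary chain is integrable, since the run lengths have a second moment. -/
lemma integrable_chain (hp : ∀ k, 0 ≤ p k) (hp1 : HasSum p 1) (hM : IsStationaryChain P p M)
    {α : ℝ} (hα : 2 < α) (hmoment : Summable (fun k : ℕ => (k : ℝ) ^ (α + 1) * p k)) (n : ℕ) :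
    Integrable (fun ω => (M n ω : ℝ)) P := by
  have h1 : Summable fun j : ℕ => ∑' i, p (i + j) * (j : ℝ) := by
    refine (Summable.of_nonneg_of_le (fun x => ?_) (fun x => ?_)
      ((summable_moment hp hp1.summable hα hmoment).comp_injective
        Prod.swap_injective) : Summable fun x : ℕ × ℕ => p (x.2 + x.1) * (x.1 : ℝ)).prod
    · exact mul_nonneg (hp _) (Nat.cast_nonneg _)
    · simp only [Function.comp, Prod.fst_swap, Prod.snd_swap]
      rw [add_comm x.1 x.2]
      refine mul_le_mul_of_nonneg_left ?_ (hp _)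
      have h2 : (0 : ℝ) ≤ x.1 := Nat.cast_nonneg _
      calc (x.1 : ℝ) ≤ ((x.1 : ℝ) + 1) ^ (1 : ℝ) := by rw [Real.rpow_one]; linarith
        _ ≤ _ := Real.rpow_le_rpow_of_exponent_le (by linarith) (by linarith)
  refine ⟨((measurable_of_countable fun a : ℕ => (a : ℝ)).comp
    (hM.measurable n)).aestronglyMeasurable, ?_⟩
  rw [HasFiniteIntegral, ← lintegral_map (f := fun a : ℕ => ‖(a : ℝ)‖ₑ)
    (measurable_of_countable _) (hM.measurable n), lintegral_countable']
  refine (ENNReal.tsum_le_tsum fun j => ?_).trans_lt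
    (b := ∑' j : ℕ, ENNReal.ofReal (∑' i, p (i + j) * (j : ℝ))) ?_
  · rw [Measure.map_apply (hM.measurable n) (measurableSet_singleton _), tsum_mul_right,
      mul_comm, ENNReal.ofReal_mul (tsum_nonneg fun i => hp _)]
    gcongr
    · rw [← ofReal_measureReal]
      exact ENNReal.ofReal_le_ofReal (measureReal_le_tail hp hp1 hM n j)
    · rw [← ofReal_norm, Real.norm_of_nonneg (Nat.cast_nonneg _)]
  · rw [← ENNReal.ofReal_tsum_of_nonneg _ h1]
    · exact ENNReal.ofReal_lt_top
    · exact fun j => tsum_nonneg fun i => mul_nonneg (hp _) (Nat.cast_nonneg _)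

end Chain

/-! ### The conditional expectation of the residual waiting time -/

section Theta

variable {Ω : Type*} [MeasurableSpace Ω] {P : Measure Ω} [IsProbabilityMeasure P]
  {p : ℕ → ℝ} {M : ℕ → Ω → ℕ} {X : ℕ → Ω → Fin 2}

lemma ae_isTrajectory (hM : IsStationaryChain P p M)
    (hXM : ∀ᵐ ω ∂P, ∀ n, X n ω = collapse (M n ω)) :
    ∀ᵐ ω ∂P, IsTrajectory (path X ω) (fun n => M n ω) := by
  filter_upwards [ae_dec hM, hXM] with ω h1 h2
  exact ⟨h1, h2⟩

/-- Two trajectories agree up to time `z + L`, the last zero being at `z`, iff they agree up to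
time `z` and the run following `z` has length at least `L`. -/
lemma history_eq_iff {Ω : Type*} {M : ℕ → Ω → ℕ} {X : ℕ → Ω → Fin 2} {ω ω₀ : Ω} (h : IsTrajectory (path X ω) (fun n => M n ω))
    (h₀ : IsTrajectory (path X ω₀) (fun n => M n ω₀)) {z L : ℕ} (hz : psi (path X ω₀) ≤ z + L)
    (hL : tau (path X ω₀) (z + L) = L) :
    history X (z + L) ω = history X (z + L) ω₀ ↔
      M z ω = 0 ∧ (∀ i ≤ z, X i ω = X i ω₀) ∧ L ≤ M (z + 1) ω := by
  have a₀ := (h₀.tau_eq_iff hz L).1 hL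
  rw [Nat.add_sub_cancel] at a₀
  have hpsi : M z ω = 0 → psi (path X ω) ≤ z + L := fun h0 =>
    (Nat.sInf_le ((h.eq_zero_iff z).2 h0)).trans (Nat.le_add_right _ _)
  constructor
  · intro hω
    have hω' : ∀ i ≤ z + L, X i ω = X i ω₀ := fun i hi => congrFun hω ⟨i, by omega⟩
    have hz0 : M z ω = 0 := by
      rw [← h.eq_zero_iff]
      exact (hω' z (by omega)).trans ((h₀.eq_zero_iff z).2 a₀.2.1)
    have ht : tau (path X ω) (z + L) = L := by
      rw [h.tau_eq_iff (hpsi hz0), Nat.add_sub_cancel]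
      refine ⟨by omega, hz0, fun j hj hjL => ?_⟩
      rw [← h.eq_one_iff]
      exact (hω' j hjL).trans ((h₀.eq_one_iff j).2 (a₀.2.2 j hj hjL))
    exact ⟨hz0, fun i hi => hω' i (by omega), ((h.tau_add_iff (hpsi hz0)).1 ht).2⟩
  · rintro ⟨hz0, hi, hle⟩
    have ht := (h.tau_add_iff (hpsi hz0)).2 ⟨hz0, hle⟩
    rw [h.tau_eq_iff (hpsi hz0), Nat.add_sub_cancel] at ht
    ext i
    by_cases hiz : (i : ℕ) ≤ z
    · exact congrArg _ (hi i hiz)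
    · have b1 := (h.eq_one_iff i).2 (ht.2.2 i (by omega) (by omega))
      have b2 := (h₀.eq_one_iff i).2 (a₀.2.2 i (by omega) (by omega))
      exact congrArg _ (b1.trans b2.symm)

/-- On an atom of `σ(X_0, …, X_{z+L})` with last zero at `z`, the integral of a function of the
residual waiting time is proportional to its mean under the shifted tail of `p`. -/
lemma exists_setIntegral_atom_eq (hp : ∀ k, 0 ≤ p k) (hp1 : HasSum p 1)
    (hM : IsStationaryChain P p M) (hX : ∀ n, Measurable (X n))
    (hT : ∀ᵐ ω ∂P, IsTrajectory (path X ω) (fun n => M n ω)) {ω₀ : Ω}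
    (h₀ : IsTrajectory (path X ω₀) (fun n => M n ω₀)) {z L : ℕ} (hz : psi (path X ω₀) ≤ z + L)
    (hL : tau (path X ω₀) (z + L) = L) :
    ∃ c : ℝ, ∀ F : ℕ → ℝ, (Summable fun l => p (l + L) * F l) →
      ∫ ω in history X (z + L) ⁻¹' {history X (z + L) ω₀}, F (sigma (path X ω) (z + L)) ∂P =
        c * ∑' l, p (l + L) * F l := by
  classical
  set G : (Fin (z + 1) → ℕ) → ℝ := fun h =>
    if ∀ i ≤ z, collapse (extend 0 h i) = X i ω₀ then 1 else 0 with hG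
  refine ⟨∫ ω, (if M z ω = 0 then G (history M z ω) else 0) ∂P, fun F hF => ?_⟩
  -- Up to a null set, the atom consists of a condition on the past of the zero at `z`, expressed by
  -- `G`, and the condition `L ≤ M_{z+1}`.
  have h1 := integral_history_mul_next hp hp1 hM z G fun r => if L ≤ r then F (r - L) else 0
  rw [integral_runLaw hp ((summable_tail_iff p F L).2 hF), tsum_tail] at h1
  rw [← h1, ← integral_indicator (measurable_history hX _ (measurableSet_singleton _))]
  refine integral_congr_ae ?_
  filter_upwards [hT] with ω h
  have hiff := history_eq_iff h h₀ hz hL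
  have hGω : G (history M z ω) = if ∀ i ≤ z, X i ω = X i ω₀ then 1 else 0 := by
    simp only [hG]
    refine if_congr (forall_congr' fun i => forall_congr' fun hi => ?_) rfl rfl
    rw [extend_history M 0 hi, ← h.collapse_eq]
    rfl
  rw [Set.indicator_apply]
  simp only [Set.mem_preimage, Set.mem_singleton_iff, hiff, hGω]
  by_cases c1 : M z ω = 0
  · by_cases c2 : ∀ i ≤ z, X i ω = X i ω₀
    · by_cases c3 : L ≤ M (z + 1) ω
      · rw [if_pos ⟨c1, c2, c3⟩, if_pos c1, if_pos c2, if_pos c3, one_mul, h.sigma_eq]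
        have := h.apply_add (z + 1) L c3
        rw [show z + L + 1 = z + 1 + L by ring, this]
      · simp [c3]
    · rw [if_neg (fun h' => c2 h'.2.1), if_neg c2]
      simp
  · simp [c1]

/-- Once a zero has been seen, `θ_n` is the conditional mean of the residual waiting time given
the age `τ(X_0^n)` of the current run. -/
lemma ae_theta_eq (hp : ∀ k, 0 ≤ p k) (hp1 : HasSum p 1)
    (hM : IsStationaryChain P p M) (hX : ∀ n, Measurable (X n))
    (hT : ∀ᵐ ω ∂P, IsTrajectory (path X ω) (fun n => M n ω))
    (hint : ∀ n, Integrable (fun ω => (M n ω : ℝ)) P)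
    (hmean : ∀ L, Summable fun l : ℕ => p (l + L) * (l : ℝ)) :
    ∀ᵐ ω ∂P, ∀ n, psi (path X ω) ≤ n →
      theta P X n ω = condMean p (fun l => (l : ℝ)) (tau (path X ω) n) := by
  -- There are only finitely many atoms for each `n`, so those of measure zero can be avoided.
  have hatoms : ∀ᵐ ω ∂P, ∀ n, ∀ h : Fin (n + 1) → Fin 2,
      P (history X n ⁻¹' {h}) = 0 → history X n ω ≠ h := by
    simp only [ae_all_iff]
    intro n h h0
    rw [ae_iff]
    simp only [ne_eq, not_not]
    exact h0
  filter_upwards [hatoms, hT] with ω₀ h1 h₀ n hn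
  obtain ⟨L, hL⟩ : ∃ L, tau (path X ω₀) n = L := ⟨_, rfl⟩
  obtain ⟨z, rfl⟩ : ∃ z, n = z + L := ⟨n - L, by have := h₀.tau_le hn; omega⟩
  rw [hL]
  set A := history X (z + L) ⁻¹' {history X (z + L) ω₀} with hA
  have hmeas := measurable_history hX (z + L)
  have hA0 : P A ≠ 0 := fun h => h1 _ _ h rfl
  have hPA : P.real A ≠ 0 := by
    rw [measureReal_def]
    exact (ENNReal.toReal_pos hA0 (measure_ne_top _ _)).ne'
  have hle : sigmaAlg X (z + L) ≤ ‹MeasurableSpace Ω› := hmeas.comap_le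
  have hsint : Integrable (fun ω => (sigma (path X ω) (z + L) : ℝ)) P := by
    refine (hint (z + L + 1)).congr ?_
    filter_upwards [hT] with ω h
    rw [h.sigma_eq]
  obtain ⟨φ, -, hφ⟩ : ∃ φ : (Fin (z + L + 1) → Fin 2) → ℝ, StronglyMeasurable φ ∧
      theta P X (z + L) = φ ∘ history X (z + L) :=
    StronglyMeasurable.exists_eq_measurable_comp
      (stronglyMeasurable_condExp (m := sigmaAlg X (z + L)))
  have hAm : MeasurableSet[sigmaAlg X (z + L)] A :=
    ⟨{history X (z + L) ω₀}, measurableSet_singleton _, rfl⟩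
  have h2 : ∫ ω in A, theta P X (z + L) ω ∂P =
      ∫ ω in A, (sigma (path X ω) (z + L) : ℝ) ∂P := setIntegral_condExp hle hsint hAm
  have h3 : ∫ ω in A, theta P X (z + L) ω ∂P = P.real A * theta P X (z + L) ω₀ := by
    have h4 : ∀ ω ∈ A, theta P X (z + L) ω = theta P X (z + L) ω₀ := by
      intro ω hω
      rw [hφ]
      exact congrArg φ hω
    rw [setIntegral_congr_fun (hle _ hAm) h4, setIntegral_const, smul_eq_mul]
  obtain ⟨c, hc⟩ := exists_setIntegral_atom_eq hp hp1 hM hX hT h₀ hn hL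
  have e1 := hc (fun l => (l : ℝ)) (hmean L)
  have e2 := hc (fun _ => 1) (by simpa using (summable_nat_add_iff L).2 hp1.summable)
  simp only [mul_one, setIntegral_const, smul_eq_mul] at e2
  have e3 := (h3.symm.trans h2).trans e1
  rw [← condMean_mul hp hp1.summable] at e3
  apply mul_left_cancel₀ hPA
  rw [e3, e2]
  ring

end Theta

/-! ### Rare times have density zero -/

/-- If the sums over runs obey the law of large numbers, then almost all times are not rare. -/
lemma IsTrajectory.tendsto_rareTimes {γ : ℝ} (hγ0 : 0 < γ) (hγ1 : γ ≤ 1) {x : ℕ → Fin 2}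
    {m : ℕ → ℕ} (h : IsTrajectory x m) {e : ℕ → ℝ} (he0 : ∀ B, 0 ≤ e B)
    (he : Tendsto e atTop (𝓝 0))
    (hlln : ∀ B, ∀ᶠ k : ℕ in atTop, |runSum
      (shifted (fun r => if B ≤ r then (r : ℝ) + 1 else 0) (e B) 0) m k| ≤
        1 * (k : ℝ) ^ (1 - γ)) :
    Tendsto (fun k : ℕ => ((rareTimes γ x k).card : ℝ) / k) atTop (𝓝 0) := by
  rw [Metric.tendsto_atTop']
  intro δ hδ
  obtain ⟨B, hB⟩ := (he.eventually (gt_mem_nhds (show 0 < δ / 8 by positivity))).exists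
  have hsmall : Tendsto (fun k : ℕ => ((B : ℝ) + 1) * (((k : ℝ)) ^ (-γ) + 1 / (k : ℝ))) atTop
      (𝓝 (((B : ℝ) + 1) * (0 + 0))) :=
    (((tendsto_rpow_neg_atTop hγ0).comp tendsto_natCast_atTop_atTop).add
      tendsto_one_div_atTop_nhds_zero_nat).const_mul _
  simp only [add_zero, mul_zero] at hsmall
  have hev := (tendsto_add_atTop_nat 1).eventually
    ((hsmall.eventually (gt_mem_nhds (show 0 < δ / 8 by positivity))).and (hlln B))
  obtain ⟨N, hN⟩ := eventually_atTop.1 hev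
  refine ⟨max N 0, fun k hk => ?_⟩
  have hk0 : 0 < k := (le_max_right _ _).trans_lt hk
  obtain ⟨g1, g2⟩ := hN k ((le_max_left _ _).trans hk.le)
  have hkpos : (0 : ℝ) < k := by exact_mod_cast hk0
  rw [Real.dist_eq, sub_zero, abs_of_nonneg (by positivity), div_lt_iff₀ hkpos]
  set K : ℝ := ((k + 1 : ℕ) : ℝ) with hK
  have hKk : K = k + 1 := by rw [hK]; push_cast; ring
  have hKpos : 0 < K := by rw [hKk]; positivity
  have hrun : runSum (fun r => if B ≤ r then (r : ℝ) + 1 else 0) m (k + 1) ≤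
      runSum (shifted (fun r => if B ≤ r then (r : ℝ) + 1 else 0) (e B) 0) m (k + 1) +
        e B * K := by
    rw [runSum, runSum, show e B * K = ∑ z ∈ Finset.range (k + 1), e B by
      rw [Finset.sum_const, Finset.card_range, nsmul_eq_mul, mul_comm], ← Finset.sum_add_distrib]
    refine Finset.sum_le_sum fun z _ => ?_
    have := he0 B
    by_cases h0 : m z = 0
    · simp [h0, shifted]
    · simpa [h0] using this
  have hcard := h.card_rareTimes_le hγ1 k B
  have hmono : (k : ℝ) ^ (1 - γ) ≤ K ^ (1 - γ) :=
    Real.rpow_le_rpow hkpos.le (by linarith) (by linarith)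
  have hpow : K ^ (1 - γ) = K ^ (-γ) * K := by
    rw [← Real.rpow_add_one hKpos.ne']; ring_nf
  have hmain : ((B : ℝ) + 1) * (K ^ (1 - γ) + 1) < δ / 8 * K := by
    have := mul_lt_mul_of_pos_right g1 hKpos
    refine lt_of_eq_of_lt ?_ this
    rw [hpow]; field_simp
  have hB0 : (0 : ℝ) ≤ B := Nat.cast_nonneg _
  have g3 := (le_abs_self _).trans g2
  have g4 : (B : ℝ) * ((k : ℝ) ^ (1 - γ) + 1) ≤ B * (K ^ (1 - γ) + 1) := by gcongr
  have g5 : e B * K ≤ δ / 8 * K := by gcongr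
  have g6 : K ≤ 2 * k := by
    have : (1 : ℝ) ≤ k := by exact_mod_cast hk0
    linarith
  nlinarith

/-! ### Convergence of the estimators along a trajectory -/

section Estimators

variable {γ : ℝ} {x : ℕ → Fin 2} {m : ℕ → ℕ} {p : ℕ → ℝ}

lemma lam_pos_and_count_le
    (hD : Tendsto (fun k : ℕ => ((rareTimes γ x k).card : ℝ) / k) atTop (𝓝 0)) {n : ℕ}
    (hn : 0 < n) : 0 < lam γ x n ∧
      (lam γ x n : ℝ) ^ (1 - γ) ≤ (count x (psi x) (lam γ x n) : ℝ) := by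
  obtain ⟨n, rfl⟩ : ∃ j, n = j + 1 := ⟨n - 1, by omega⟩
  obtain ⟨a, b⟩ := lam_succ_mem (exists_gt_of_rareTimes hD) n
  exact ⟨(Nat.zero_le _).trans_lt a, b⟩

lemma IsTrajectory.tendsto_hEst (h : IsTrajectory x m)
    (hD : Tendsto (fun k : ℕ => ((rareTimes γ x k).card : ℝ) / k) atTop (𝓝 0))
    (hlln : ∀ ε : ℝ, 0 < ε → ∀ᶠ k : ℕ in atTop, ∀ L : ℕ, ∀ t ≤ k,
      |runSum (shifted (fun l => (l : ℝ)) (condMean p (fun l => (l : ℝ)) L) L) m t| ≤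
        ε * (k : ℝ) ^ (1 - γ)) :
    Tendsto (fun n => |hEst γ x n - condMean p (fun l => (l : ℝ)) (tau x (lam γ x n))|)
      atTop (𝓝 0) := by
  rw [Metric.tendsto_atTop']
  intro δ hδ
  obtain ⟨N, hN⟩ := eventually_atTop.1
    ((tendsto_lam_atTop hD).eventually (hlln (δ / 4) (by positivity)))
  refine ⟨N, fun n hn => ?_⟩
  obtain ⟨c1, c2⟩ := lam_pos_and_count_le hD (show 0 < n by omega)
  have := h.abs_average_sub_le c1 (lam_eq (exists_gt_of_rareTimes hD) n).2 c2 (fun l => (l : ℝ))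
    (condMean p (fun l => (l : ℝ)) (tau x (lam γ x n))) (δ / 4)
    (hN n hn.le (tau x (lam γ x n)))
  rw [Real.dist_eq, sub_zero, abs_abs]
  refine lt_of_le_of_lt this ?_
  linarith

lemma condMean_single (w : ℝ) (L l : ℕ) :
    condMean p (fun a => if a = l then w else 0) L = w * residual p L l := by
  have h1 : ∑' a, p (a + L) * (if a = l then w else 0) = p (l + L) * w := by
    refine (tsum_eq_single l ?_).trans (by rw [if_pos rfl])
    intro a ha
    simp [ha]
  rw [condMean, residual, h1]
  ring

/-- The `ℓ¹` distance is controlled by giving the point mass at `l` a weight `w l` with summable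
inverse. -/
lemma IsTrajectory.tendsto_pEst (h : IsTrajectory x m)
    (hD : Tendsto (fun k : ℕ => ((rareTimes γ x k).card : ℝ) / k) atTop (𝓝 0))
    {w : ℕ → ℝ} (hw0 : ∀ l, 0 < w l) (hwsum : Summable fun l => (w l)⁻¹)
    (hlln : ∀ ε : ℝ, 0 < ε → ∀ᶠ k : ℕ in atTop, ∀ y : ℕ × ℕ, ∀ t ≤ k,
      |runSum (shifted (fun a => if a = y.2 then w y.2 else 0)
        (condMean p (fun a => if a = y.2 then w y.2 else 0) y.1) y.1) m t| ≤
        ε * (k : ℝ) ^ (1 - γ)) :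
    Tendsto (fun n => ∑' l, |pEst γ x n l - residual p (tau x (lam γ x n)) l|)
      atTop (𝓝 0) := by
  rw [Metric.tendsto_atTop']
  intro δ hδ
  set S := ∑' l, (w l)⁻¹ with hS
  have hS0 : 0 ≤ S := tsum_nonneg fun l => (inv_pos.2 (hw0 l)).le
  set ε := δ / (4 * (S + 1)) with hε
  have hε0 : 0 < ε := by positivity
  obtain ⟨N, hN⟩ := eventually_atTop.1 ((tendsto_lam_atTop hD).eventually (hlln ε hε0))
  refine ⟨N, fun n hn => ?_⟩
  obtain ⟨c1, c2⟩ := lam_pos_and_count_le hD (show 0 < n by omega)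
  have hterm : ∀ l, |pEst γ x n l - residual p (tau x (lam γ x n)) l| ≤ 2 * ε * (w l)⁻¹ := by
    intro l
    have := h.abs_average_sub_le c1 (lam_eq (exists_gt_of_rareTimes hD) n).2 c2
      (fun a => if a = l then w l else 0)
      (condMean p (fun a => if a = l then w l else 0) (tau x (lam γ x n))) ε
      (hN n hn.le (tau x (lam γ x n), l))
    have e2 : 1 / (sampleSize γ x n : ℝ) * (∑ i ∈ Finset.Ico (kappa γ x n) (lam γ x n),
        if tau x i = tau x (lam γ x n) then (if sigma x i = l then w l else 0) else 0) =
        w l * pEst γ x n l := by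
      have hite : ∀ i, (if tau x i = tau x (lam γ x n) then (if sigma x i = l then w l else 0)
          else 0) = w l * if tau x i = tau x (lam γ x n) ∧ sigma x i = l then (1 : ℝ) else 0 := by
        intro i
        rw [ite_and, mul_ite, mul_ite, mul_one, mul_zero]
      simp_rw [hite, ← Finset.mul_sum]
      rw [pEst]
      ring
    rw [e2, condMean_single, ← mul_sub, abs_mul, abs_of_pos (hw0 l)] at this
    rw [← div_eq_mul_inv, le_div_iff₀ (hw0 l)]
    linarith
  have hsum2 := hwsum.mul_left (2 * ε)
  have habs : Summable fun l => |pEst γ x n l - residual p (tau x (lam γ x n)) l| :=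
    Summable.of_nonneg_of_le (fun l => abs_nonneg _) hterm hsum2
  have h1 := habs.tsum_le_tsum hterm hsum2
  rw [tsum_mul_left, ← hS] at h1
  rw [Real.dist_eq, sub_zero, abs_of_nonneg (tsum_nonneg fun l => abs_nonneg _)]
  refine h1.trans_lt ?_
  have h2 : 2 * ε * S ≤ 2 * ε * (S + 1) := by gcongr; linarith
  have h3 : 2 * ε * (S + 1) = δ / 2 := by rw [hε]; field_simp; ring
  linarith

end Estimators

/-! ### Second moments of the functions to which the law of large numbers is applied -/

section SecondMoments

variable {p : ℕ → ℝ} (hp : ∀ k, 0 ≤ p k) {α : ℝ} (hα : 2 < α)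
  (hmom : Summable fun x : ℕ × ℕ => p (x.2 + x.1) * ((x.2 : ℝ) + 1) ^ α)

lemma sq_le_rpow {α : ℝ} (hα : 2 < α) (l : ℕ) : ((l : ℝ) + 1) ^ 2 ≤ ((l : ℝ) + 1) ^ α := by
  have h2 : (0 : ℝ) ≤ l := Nat.cast_nonneg _
  calc ((l : ℝ) + 1) ^ 2 = ((l : ℝ) + 1) ^ (2 : ℝ) := by norm_cast
    _ ≤ _ := Real.rpow_le_rpow_of_exponent_le (by linarith) hα.le

include hp hα hmom

lemma summable_residual_sq : Summable fun x : ℕ × ℕ => p (x.2 + x.1) * (x.2 : ℝ) ^ 2 := by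
  refine Summable.of_nonneg_of_le (fun x => mul_nonneg (hp _) (sq_nonneg _))
    (fun x => mul_le_mul_of_nonneg_left ((sq_le_rpow hα x.2).trans' ?_) (hp _)) hmom
  gcongr
  linarith

lemma summable_long_sq (B : ℕ) :
    Summable fun l : ℕ => p (l + 0) * (if B ≤ l then (l : ℝ) + 1 else 0) ^ 2 := by
  refine Summable.of_nonneg_of_le (fun l => mul_nonneg (hp _) (sq_nonneg _))
    (fun l => mul_le_mul_of_nonneg_left ((sq_le_rpow hα l).trans' ?_) (hp _))
    (hmom.comp_injective (Prod.mk_right_injective 0))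
  split_ifs
  · exact le_rfl
  · simp only [ne_eq, OfNat.ofNat_ne_zero, not_false_eq_true, zero_pow]
    positivity

lemma tendsto_condMean_long (hs : Summable p) :
    Tendsto (fun B : ℕ => condMean p (fun l => if B ≤ l then (l : ℝ) + 1 else 0) 0)
      atTop (𝓝 0) := by
  have h1 := summable_of_summable_sq hp hs (summable_long_sq hp hα hmom 0)
  have h2 : Tendsto (fun B : ℕ => ∑' l : ℕ, p (l + 0) * (if B ≤ l then (l : ℝ) + 1 else 0))
      atTop (𝓝 (∑' _ : ℕ, (0 : ℝ))) := by
    refine tendsto_tsum_of_dominated_convergence h1 (fun l => ?_) (Eventually.of_forall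
      fun B l => ?_)
    · refine tendsto_const_nhds.congr' ?_
      filter_upwards [eventually_gt_atTop l] with B hB
      rw [if_neg (by omega), mul_zero]
    · rw [Real.norm_of_nonneg (mul_nonneg (hp _) (by split_ifs <;> positivity))]
      refine mul_le_mul_of_nonneg_left ?_ (hp _)
      rw [if_pos (Nat.zero_le l)]
      split_ifs
      · exact le_rfl
      · positivity
  simpa [condMean] using h2.div_const (∑' i, p (i + 0))

end SecondMoments

lemma ae_tendsto_rareTimes {Ω : Type*} [MeasurableSpace Ω] {P : Measure Ω}
    [IsProbabilityMeasure P] {p : ℕ → ℝ} {M : ℕ → Ω → ℕ} {X : ℕ → Ω → Fin 2}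
    (hp : ∀ k, 0 ≤ p k) (hp1 : HasSum p 1) (hM : IsStationaryChain P p M)
    (hT : ∀ᵐ ω ∂P, IsTrajectory (path X ω) (fun n => M n ω)) {α : ℝ} (hα : 2 < α)
    (hmom : Summable fun x : ℕ × ℕ => p (x.2 + x.1) * ((x.2 : ℝ) + 1) ^ α)
    {γ : ℝ} (hγ0 : 0 < γ) (hγ : γ < 1 / 2) :
    ∀ᵐ ω ∂P, Tendsto (fun k : ℕ => ((rareTimes γ (path X ω) k).card : ℝ) / k) atTop (𝓝 0) := by
  have hlln := ae_all_iff.2 fun B : ℕ =>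
    ae_eventually_abs_runSum_shifted_le hp hp1 hM
      (fun (_ : Unit) l => if B ≤ l then (l : ℝ) + 1 else 0) (fun _ => 0)
      (fun _ => summable_long_sq hp hα hmom B) Summable.of_finite hγ
  filter_upwards [hT, hlln] with ω h glong
  refine h.tendsto_rareTimes hγ0 (by linarith) (fun B => ?_)
    (tendsto_condMean_long hp hα hmom hp1.summable) fun B => ?_
  · exact div_nonneg (tsum_nonneg fun l => mul_nonneg (hp _) (by
      simp only
      split_ifs <;> positivity))
      (tsum_nonneg fun i => hp _)
  · filter_upwards [glong B 1 one_pos] with k hk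
    exact hk () k le_rfl

end BinaryRenewal

end

open BinaryRenewal in
theorem theorem1 {Ω : Type*} [MeasurableSpace Ω] (P : Measure Ω) [IsProbabilityMeasure P]
    (p : ℕ → ℝ) (hp_nonneg : ∀ k, 0 ≤ p k) (hp_sum : HasSum p 1)
    (X : ℕ → Ω → Fin 2) (hX : BinaryRenewal.IsBinaryRenewal P p X)
    (α : ℝ) (hα : 2 < α) (hmoment : Summable (fun k : ℕ => (k : ℝ) ^ (α + 1) * p k))
    (γ : ℝ) (hγ_pos : 0 < γ) (hγ_lt : γ < min (1 - 2 / α) (1 / 3)) :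
    ∀ᵐ ω ∂P,
      Tendsto (fun n : ℕ => (BinaryRenewal.lam γ (BinaryRenewal.path X ω) n : ℝ) / (n : ℝ))
        atTop (𝓝 1) ∧
      Tendsto (fun n : ℕ => |BinaryRenewal.hEst γ (BinaryRenewal.path X ω) n -
          BinaryRenewal.theta P X (BinaryRenewal.lam γ (BinaryRenewal.path X ω) n) ω|)
        atTop (𝓝 0) ∧
      Tendsto (fun n : ℕ => ∑' l : ℕ, |BinaryRenewal.pEst γ (BinaryRenewal.path X ω) n l -
          BinaryRenewal.residual p
            (BinaryRenewal.tau (BinaryRenewal.path X ω)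
              (BinaryRenewal.lam γ (BinaryRenewal.path X ω) n)) l|)
        atTop (𝓝 0) := by
  obtain ⟨hXm, M, hM, hXM⟩ := hX
  have hγ2 : γ < 1 / 2 := by linarith [hγ_lt.trans_le (min_le_right _ _)]
  have hs := hp_sum.summable
  have hT := ae_isTrajectory hM hXM
  have hmom := summable_moment hp_nonneg hs hα hmoment
  have hsq := summable_residual_sq hp_nonneg hα hmom
  have hsqL := fun L : ℕ => hsq.comp_injective (Prod.mk_right_injective L)
  have hmeanLLN := ae_eventually_abs_runSum_shifted_le hp_nonneg hp_sum hM
    (fun (_ : ℕ) l => (l : ℝ)) (fun L => L) hsqL hsq.prod hγ2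
  -- The weights `w` have summable inverses because `α / 2 > 1`, and their squares have exponent
  -- `α`, the largest one that the moment assumption allows after summation over all levels.
  set w : ℕ → ℝ := fun l => ((l : ℝ) + 1) ^ (α / 2) with hw
  have hw0 : ∀ l, 0 < w l := fun l => by simp only [hw]; positivity
  have hwsum : Summable fun l => (w l)⁻¹ := by
    have h1 := (summable_nat_add_iff 1).2 (Real.summable_nat_rpow_inv.2
      (show 1 < α / 2 by linarith))
    refine h1.congr fun l => ?_
    simp only [hw]; push_cast; rfl
  have hpoint : ∀ (x : ℕ × ℕ) (a : ℕ), a ≠ x.2 →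
      p (a + x.1) * (if a = x.2 then w x.2 else 0) ^ 2 = 0 := fun x a ha => by simp [ha]
  have hpointLLN := ae_eventually_abs_runSum_shifted_le hp_nonneg hp_sum hM
    (fun (x : ℕ × ℕ) a => if a = x.2 then w x.2 else 0) (fun x => x.1)
    (fun x => (hasSum_single x.2 (hpoint x)).summable)
    (by
      refine hmom.congr fun x => ?_
      rw [tsum_eq_single x.2 (hpoint x), if_pos rfl]
      simp only [hw]
      rw [← Real.rpow_natCast, ← Real.rpow_mul (by positivity)]
      norm_num) hγ2
  filter_upwards [hT, hmeanLLN, hpointLLN,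
    ae_tendsto_rareTimes hp_nonneg hp_sum hM hT hα hmom hγ_pos hγ2,
    ae_theta_eq hp_nonneg hp_sum hM hXm hT
      (integrable_chain hp_nonneg hp_sum hM hα hmoment)
      (fun L => summable_of_summable_sq hp_nonneg hs (hsqL L))] with ω h gmean gpoint hD gtheta
  refine ⟨tendsto_lam_div hD, ?_, h.tendsto_pEst hD hw0 hwsum gpoint⟩
  refine (h.tendsto_hEst hD gmean).congr fun n => ?_
  rw [gtheta _ (lam_eq (exists_gt_of_rareTimes hD) n).2]
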